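/- **Conventions.** All vector spaces are over $\mathbb C$; $W((x))$ denotes formal Laurent series, $W((x_1,x_2))=W[[x_1,x_2]][x_1^{-1},x_2^{-1}]$, and a power $(\pm x_i\pm x_j)^n$, $n\in\mathbb Z$, is expanded in nonnegative powers of the second variable written. A *nonlocal vertex algebra* is a vector space $V$ with a vector $\mathbf 1$ and a linear map $Y(\cdot,x):V\to \mathrm{Hom}(V,V((x)))$ such that $Y(\mathbf 1,x)v=v$, $Y(v,x)\mathbf 1\in V[[x]]$, $\lim_{x\to0}Y(v,x)\mathbf 1=v$, and for all $u,v,w\in V$ there is $k\ge 0$ with $$(x_0+x_2)^kY(u,x_0+x_2)Y(v,x_2)w=(x_0+x_2)^kY(Y(u,x_0)v,x_2)w .$$ A *$V$-module* is a vector space $W$ with a linear map $Y_W(\cdot,x):V\to\mathrm{Hom}(W,W((x)))$ such that $Y_W(\mathbf 1,x)=1_W$ and for all $u,v\in V$, $w\in W$ there is $l\ge0$ with $(x_0+x_2)^lY_W(u,x_0+x_2)Y_W(v,x_2)w=(x_0+x_2)^lY_W(Y(u,x_0)v,x_2)w$. Write $Y(x)(u\otimes v)=Y(u,x)v$ and $Y_W(x)(v\otimes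 w)=Y_W(v,x)w$. Let $U,V$ be nonlocal vertex algebras. A *twisting operator* for $(U,V)$ is a linear map $R(x):V\otimes U\to U\otimes V\otimes\mathbb C((x))$ with $R(x)(v\otimes\mathbf 1)=\mathbf 1\otimes v$, $R(x)(\mathbf 1\otimes u)=u\otimes\mathbf 1$ for all $u\in U$, $v\in V$, and $$R(x_1)(1\otimes Y(x_2))=(Y(x_2)\otimes1)R^{23}(x_1)R^{12}(x_1+x_2),\qquad R(x_1)(Y(x_2)\otimes1)=(1\otimes Y(x_2))R^{12}(x_1-x_2)R^{23}(x_1).$$ It is *invertible* if its $\mathbb C((x))$-linear extension $V\otimes U\otimes\mathbb C((x))\to U\otimes V\otimes\mathbb C((x))$ is invertible; $R^{-1}(x):U\otimes V\to V\otimes U\otimes\mathbb C((x))$ is the restriction of the inverse. The *twisted tensor product* $U\otimes_RV$ is $U\otimes V$ with vacuum $\mathbf 1\otimes\mathbf 1$ and vertex operator map $Y_R(x)=(Y(x)\otimes Y(x))R^{23}(-x)$, i.e. $Y_R(u\otimes v,x)(u'\otimes v')=\sum_i f_i(-x)\,Y(u,x)u_i'\otimes Y(v_i,x)v'$ if $R(x)(v\otimes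 u')=\sum_i u_i'\otimes v_i\otimes f_i(x)$. **Proposition.** Let $U$ and $V$ be nonlocal vertex algebras and $R(x)$ an invertible twisting operator for $(U,V)$. Let $W$ be a vector space equipped with a $U$-module structure $Y_W^U$ and a $V$-module structure $Y_W^V$. Assume that for all $u\in U$, $v\in V$: 1. $Y_W^U(u,x_1)Y_W^V(v,x_2)\in\mathrm{Hom}(W,W((x_1,x_2)))$; 2. for every $w\in W$, $\;Y_W^U(u,x_1)Y_W^V(v,x_2)w=Y_W^V(x_2)(1\otimes Y_W^U(x_1))(R^{-1})^{12}(-x_2+x_1)(u\otimes v\otimes w)$; 3. there is an integer $k\ge0$ such that for every $w\in W$ $$(x_2-x_1)^kY_W^V(v,x_1)Y_W^U(u,x_2)w=(x_2-x_1)^kY_W^U(x_2)(1\otimes Y_W^V(x_1))R^{12}(x_2-x_1)(v\otimes u\otimes w).$$ Then there is a unique $U\otimes_RV$-module structure $Y_R^W$ on $W$ extending $Y_W^U$ and $Y_W^V$, that is, with $Y_R^W(u\otimes\mathbf 1,x)=Y_W^U(u,x)$ and $Y_R^W(\mathbf 1\otimes v,x)=Y_W^V(v,x)$ for all $u\in U$,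 $v\in V$. It is given by $$Y_R^W(u\otimes v,x)w=\bigl(Y_W^U(u,x_1)Y_W^V(v,x)w\bigr)\big|_{x_1=x}\qquad(u\in U,\ v\in V,\ w\in W).$$ -/

import Mathlib

open scoped TensorProduct LaurentSeries

noncomputable section

/-!
Conventions. All vector spaces are over `ℂ`. `W⸨X⸩` is `W((x))`, the space of formal Laurent series
`∑ n, wₙ xⁿ` with `wₙ ∈ W` and `wₙ = 0` for `n` sufficiently negative.
A formal series in two variables `x, y` (infinite in all directions) with coefficients in `W` is the
function `ℤ → ℤ → W` whose value at `m n` is the coefficient of `x ^ m * y ^ n`.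
Every `∑ᶠ` below has only finitely many nonzero terms for the objects it is applied to.
-/

namespace TwistedTensor

section FormalSeries

variable {M N P W : Type*} [AddCommGroup M] [Module ℂ M] [AddCommGroup N] [Module ℂ N]
  [AddCommGroup P] [Module ℂ P] [AddCommGroup W] [Module ℂ W]

/-- The coefficient of `x ^ n`, as a linear map `W((x)) → W`. -/
def coeffL (n : ℤ) : W⸨X⸩ →ₗ[ℂ] W := HahnSeries.coeff.linearMap n

@[simp] theorem coeffL_apply (n : ℤ) (f : W⸨X⸩) : coeffL n f = f.coeff n := rfl

theorem exists_coeff_eq_zero {W : Type*} [AddCommGroup W] (f : W⸨X⸩) : ∃ n₀ : ℤ, ∀ n < n₀, f.coeff n = 0 :=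
  ⟨f.order, fun _ hn => HahnSeries.coeff_eq_zero_of_lt_order hn⟩

theorem finite_support_conv (B : M →ₗ[ℂ] N →ₗ[ℂ] P) (f : M⸨X⸩) (g : N⸨X⸩) (n : ℤ) :
    (Function.support fun i : ℤ => B (f.coeff i) (g.coeff (n - i))).Finite := by
  obtain ⟨a, ha⟩ := exists_coeff_eq_zero f
  obtain ⟨b, hb⟩ := exists_coeff_eq_zero g
  refine (Set.finite_Icc a (n - b)).subset fun i hi => ?_
  rw [Function.mem_support] at hi
  constructor
  · by_contra h
    exact hi (by rw [ha i (by omega)]; simp)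
  · by_contra h
    exact hi (by rw [hb (n - i) (by omega)]; simp)

/-- The product `M((x)) × N((x)) → P((x))` induced by a bilinear map `B : M × N → P`: the coefficient
of `x ^ n` in the product of `∑ fᵢ xⁱ` and `∑ gⱼ xʲ` is `∑_{i + j = n} B (fᵢ, gⱼ)`. -/
def laurentMul (B : M →ₗ[ℂ] N →ₗ[ℂ] P) : M⸨X⸩ →ₗ[ℂ] N⸨X⸩ →ₗ[ℂ] P⸨X⸩ :=
  LinearMap.mk₂ ℂ
    (fun f g => HahnSeries.ofSuppBddBelow
      (fun n => ∑ᶠ i : ℤ, B (f.coeff i) (g.coeff (n - i))) (by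
        obtain ⟨a, ha⟩ := exists_coeff_eq_zero f
        obtain ⟨b, hb⟩ := exists_coeff_eq_zero g
        refine ⟨a + b, fun n hn => ?_⟩
        by_contra hlt
        refine hn ?_
        refine finsum_eq_zero_of_forall_eq_zero fun i => ?_
        rcases lt_or_ge i a with h | h
        · rw [ha i h]; simp
        · rw [hb (n - i) (by omega)]; simp))
    (fun f f' g => by
      ext n
      simp only [HahnSeries.coeff_ofSuppBddBelow, HahnSeries.coeff_add, map_add,
        LinearMap.add_apply]
      exact finsum_add_distrib (finite_support_conv B f g n) (finite_support_conv B f' g n))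
    (fun c f g => by
      ext n
      simp only [HahnSeries.coeff_ofSuppBddBelow, HahnSeries.coeff_smul, map_smul,
        LinearMap.smul_apply]
      exact (smul_finsum' c (finite_support_conv B f g n)).symm)
    (fun f g g' => by
      ext n
      simp only [HahnSeries.coeff_ofSuppBddBelow, HahnSeries.coeff_add, map_add]
      exact finsum_add_distrib (finite_support_conv B f g n) (finite_support_conv B f g' n))
    (fun c f g => by
      ext n
      simp only [HahnSeries.coeff_ofSuppBddBelow, HahnSeries.coeff_smul, map_smul]
      exact (smul_finsum' c (finite_support_conv B f g n)).symm)

theorem laurentMul_coeff (B : M →ₗ[ℂ] N →ₗ[ℂ] P) (f : M⸨X⸩) (g : N⸨X⸩) (n : ℤ) :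
    (laurentMul B f g).coeff n = ∑ᶠ i : ℤ, B (f.coeff i) (g.coeff (n - i)) := rfl

/-- The substitution `f(x) ↦ f(-x)` on `W((x))`. -/
def negVar : W⸨X⸩ →ₗ[ℂ] W⸨X⸩ where
  toFun f := HahnSeries.ofSuppBddBelow (fun n => Int.negOnePow n • f.coeff n) (by
    obtain ⟨a, ha⟩ := exists_coeff_eq_zero f
    refine ⟨a, fun n hn => ?_⟩
    by_contra h
    exact hn (by simp [ha n (not_le.mp h)]))
  map_add' f g := by
    ext n
    simp [smul_add]
  map_smul' c f := by
    ext n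
    simp only [HahnSeries.coeff_ofSuppBddBelow, HahnSeries.coeff_smul, RingHom.id_apply]
    exact smul_comm _ _ _

theorem negVar_coeff (f : W⸨X⸩) (n : ℤ) :
    (negVar f).coeff n = Int.negOnePow n • f.coeff n := rfl

/-- For signs `ε, δ`, the coefficient of `x ^ (a - j) * y ^ j` in `(ε x + δ y) ^ a`, where for negative
`a` the power is expanded in nonnegative powers of the second variable `y`. -/
def binomCoeff (ε δ : ℤˣ) (a : ℤ) (j : ℕ) : ℤ :=
  ((ε ^ (a - j) * δ ^ j : ℤˣ) : ℤ) * Ring.choose a j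

/-- Multiplication of a formal series in `x, y` by `ε x + δ y`. -/
def mulLin (ε δ : ℤˣ) (A : ℤ → ℤ → W) : ℤ → ℤ → W :=
  fun m n => ε • A (m - 1) n + δ • A m (n - 1)

/-- A formal series in `x, y` lies in `W((x, y)) = W[[x, y]][x⁻¹, y⁻¹]`. -/
def IsLaurent₂ (A : ℤ → ℤ → W) : Prop :=
  ∃ N : ℤ, ∀ m n : ℤ, m < N ∨ n < N → A m n = 0

end FormalSeries

section VertexAlgebra

variable {V W : Type*} [AddCommGroup V] [Module ℂ V] [AddCommGroup W] [Module ℂ W]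

/-- For `Y(·, x) : V → Hom (W, W((x)))`, the coefficient of `x ^ n` as a bilinear map `V × W → W`. -/
def mode (Y : V →ₗ[ℂ] W →ₗ[ℂ] W⸨X⸩) (n : ℤ) : V →ₗ[ℂ] W →ₗ[ℂ] W :=
  Y.compr₂ (coeffL n)

theorem mode_apply (Y : V →ₗ[ℂ] W →ₗ[ℂ] W⸨X⸩) (n : ℤ) (v : V) (w : W) :
    mode Y n v w = (Y v w).coeff n := rfl

/-- A vacuum vector `𝟏` and a vertex operator map `Y(·, x) : V → Hom (V, V((x)))`. -/
structure VertexData (V : Type*) [AddCommGroup V] [Module ℂ V] where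
  vac : V
  Y : V →ₗ[ℂ] V →ₗ[ℂ] V⸨X⸩

/-- Weak associativity for a triple `u, v, w`: for some `l : ℕ`,
`(x₀ + x₂) ^ l * YW(u, x₀ + x₂) YW(v, x₂) w = (x₀ + x₂) ^ l * YW(Y(u, x₀) v, x₂) w`,
as an equality of formal series in `x₀, x₂`. On the left the powers of `x₀ + x₂` are expanded in
nonnegative powers of `x₂`. -/
def WeakAssoc (Y : V →ₗ[ℂ] V →ₗ[ℂ] V⸨X⸩) (YW : V →ₗ[ℂ] W →ₗ[ℂ] W⸨X⸩) (u v : V) (w : W) : Prop :=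
  ∃ l : ℕ,
    (mulLin 1 1)^[l]
        (fun p q => ∑ᶠ j : ℕ, binomCoeff 1 1 (p + j) j • mode YW (p + j) u (mode YW (q - j) v w)) =
      (mulLin 1 1)^[l] (fun p q => mode YW q (mode Y p u v) w)

/-- `(V, Y, 𝟏)` is a nonlocal vertex algebra. -/
structure VertexData.IsNonlocalVertexAlgebra (A : VertexData V) : Prop where
  vac_left : ∀ v : V, A.Y A.vac v = HahnSeries.single 0 v
  vac_right_regular : ∀ (v : V) (n : ℤ), n < 0 → (A.Y v A.vac).coeff n = 0
  vac_right_limit : ∀ v : V, (A.Y v A.vac).coeff 0 = v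
  weakAssoc : ∀ u v w : V, WeakAssoc A.Y A.Y u v w

/-- `YW(·, x) : V → Hom (W, W((x)))` makes `W` a module for `(V, Y, 𝟏)`. -/
structure VertexData.IsModule (A : VertexData V) (YW : V →ₗ[ℂ] W →ₗ[ℂ] W⸨X⸩) : Prop where
  vac_left : ∀ w : W, YW A.vac w = HahnSeries.single 0 w
  weakAssoc : ∀ (u v : V) (w : W), WeakAssoc A.Y YW u v w

end VertexAlgebra

section TwistingOperator

variable {M N : Type*} [AddCommGroup M] [Module ℂ M] [AddCommGroup N] [Module ℂ N]

/-- For a linear map `S(x) : M → N ⊗ ℂ((x))`, the coefficient of `x ^ n` as a linear map `M → N`. -/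
def opCoeff (S : M →ₗ[ℂ] N ⊗[ℂ] ℂ⸨X⸩) (n : ℤ) : M →ₗ[ℂ] N :=
  (TensorProduct.rid ℂ N).toLinearMap ∘ₗ LinearMap.lTensor N (coeffL n) ∘ₗ S

/-- The multiplication of `ℂ((x))`, as a `ℂ`-bilinear map. -/
def scalarMul : ℂ⸨X⸩ →ₗ[ℂ] ℂ⸨X⸩ →ₗ[ℂ] ℂ⸨X⸩ :=
  LinearMap.mk₂ ℂ (fun f g => f * g) add_mul
    (fun c f g => by rw [← HahnSeries.C_mul_eq_smul, ← HahnSeries.C_mul_eq_smul, mul_assoc]) mul_add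
    (fun c f g => by rw [← HahnSeries.C_mul_eq_smul, ← HahnSeries.C_mul_eq_smul, mul_left_comm])

/-- The `ℂ((x))`-linear extension `M ⊗ ℂ((x)) → N ⊗ ℂ((x))` of `S(x) : M → N ⊗ ℂ((x))`,
`m ⊗ f ↦ f(x) S(x) m`. -/
def laurentExtend (S : M →ₗ[ℂ] N ⊗[ℂ] ℂ⸨X⸩) : M ⊗[ℂ] ℂ⸨X⸩ →ₗ[ℂ] N ⊗[ℂ] ℂ⸨X⸩ :=
  LinearMap.lTensor N (TensorProduct.lift scalarMul) ∘ₗ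
    (TensorProduct.assoc ℂ N ℂ⸨X⸩ ℂ⸨X⸩).toLinearMap ∘ₗ LinearMap.rTensor ℂ⸨X⸩ S

/-- `S(x)` is invertible: its `ℂ((x))`-linear extension is. -/
def IsInvertibleOp (S : M →ₗ[ℂ] N ⊗[ℂ] ℂ⸨X⸩) : Prop :=
  Function.Bijective (laurentExtend S)

/-- The inverse of an invertible `S(x)`, restricted to `N`: a linear map
`S⁻¹(x) : N → M ⊗ ℂ((x))`. -/
def invOp (S : M →ₗ[ℂ] N ⊗[ℂ] ℂ⸨X⸩) (hS : IsInvertibleOp S) : N →ₗ[ℂ] M ⊗[ℂ] ℂ⸨X⸩ :=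
  (LinearEquiv.ofBijective (laurentExtend S) hS).symm.toLinearMap ∘ₗ
    (TensorProduct.mk ℂ N ℂ⸨X⸩).flip 1

variable {U V : Type*} [AddCommGroup U] [Module ℂ U] [AddCommGroup V] [Module ℂ V]

/-- For `T : V ⊗ U → U ⊗ V`, the map `T ⊗ 1 : V ⊗ U ⊗ M → U ⊗ V ⊗ M`. -/
def on12 (T : V ⊗[ℂ] U →ₗ[ℂ] U ⊗[ℂ] V) : V ⊗[ℂ] (U ⊗[ℂ] M) →ₗ[ℂ] U ⊗[ℂ] (V ⊗[ℂ] M) :=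
  (TensorProduct.assoc ℂ U V M).toLinearMap ∘ₗ LinearMap.rTensor M T ∘ₗ
    (TensorProduct.assoc ℂ V U M).symm.toLinearMap

/-- For `T : V ⊗ U → U ⊗ V`, the map `1 ⊗ T : M ⊗ V ⊗ U → M ⊗ U ⊗ V`. -/
def on23 (T : V ⊗[ℂ] U →ₗ[ℂ] U ⊗[ℂ] V) : M ⊗[ℂ] (V ⊗[ℂ] U) →ₗ[ℂ] M ⊗[ℂ] (U ⊗[ℂ] V) :=
  LinearMap.lTensor M T

/-- For a bilinear map `B : U × U → U`, the map `B ⊗ 1 : U ⊗ U ⊗ V → U ⊗ V`. -/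
def mulLeft (B : U →ₗ[ℂ] U →ₗ[ℂ] U) : U ⊗[ℂ] (U ⊗[ℂ] V) →ₗ[ℂ] U ⊗[ℂ] V :=
  LinearMap.rTensor V (TensorProduct.lift B) ∘ₗ (TensorProduct.assoc ℂ U U V).symm.toLinearMap

/-- For a bilinear map `B : V × V → V`, the map `1 ⊗ B : U ⊗ V ⊗ V → U ⊗ V`. -/
def mulRight (B : V →ₗ[ℂ] V →ₗ[ℂ] V) : U ⊗[ℂ] (V ⊗[ℂ] V) →ₗ[ℂ] U ⊗[ℂ] V :=
  LinearMap.lTensor U (TensorProduct.lift B)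

/-- `R(x) : V ⊗ U → U ⊗ V ⊗ ℂ((x))` is a twisting operator for the ordered pair `(U, V)`. The two
hexagon-type axioms are
`R(x₁)(1 ⊗ Y(x₂)) = (Y(x₂) ⊗ 1) R²³(x₁) R¹²(x₁ + x₂)` on `V ⊗ U ⊗ U` and
`R(x₁)(Y(x₂) ⊗ 1) = (1 ⊗ Y(x₂)) R¹²(x₁ - x₂) R²³(x₁)` on `V ⊗ V ⊗ U`,
written as the equality of the coefficients of `x₁ ^ m * x₂ ^ n` on pure tensors; powers of
`x₁ ± x₂` are expanded in nonnegative powers of `x₂`. -/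
structure IsTwistingOperator (A : VertexData U) (B : VertexData V)
    (R : V ⊗[ℂ] U →ₗ[ℂ] (U ⊗[ℂ] V) ⊗[ℂ] ℂ⸨X⸩) : Prop where
  vac_right : ∀ v : V, R (v ⊗ₜ A.vac) = (A.vac ⊗ₜ v) ⊗ₜ 1
  vac_left : ∀ u : U, R (B.vac ⊗ₜ u) = (u ⊗ₜ B.vac) ⊗ₜ 1
  comp_left : ∀ (v : V) (u u' : U) (m n : ℤ),
    opCoeff R m (v ⊗ₜ mode A.Y n u u') =
      ∑ᶠ s : ℤ × ℕ, binomCoeff 1 1 s.1 s.2 •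
        mulLeft (mode A.Y (n - s.2))
          (on23 (opCoeff R (m - (s.1 - s.2))) (on12 (opCoeff R s.1) (v ⊗ₜ (u ⊗ₜ u'))))
  comp_right : ∀ (v v' : V) (u : U) (m n : ℤ),
    opCoeff R m (mode B.Y n v v' ⊗ₜ u) =
      ∑ᶠ s : ℤ × ℕ, binomCoeff 1 (-1) s.1 s.2 •
        mulRight (mode B.Y (n - s.2))
          (on12 (opCoeff R s.1) (on23 (opCoeff R (m - (s.1 - s.2))) (v ⊗ₜ (v' ⊗ₜ u))))

/-- The linear map `(U ⊗ V) ⊗ ℂ((x)) → (U ⊗ V)((x))`,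
`(u'' ⊗ v'') ⊗ f ↦ f(-x) Y(u, x) u'' ⊗ Y(v'', x) v'`. -/
def twistedAux (A : VertexData U) (B : VertexData V) :
    U →ₗ[ℂ] V →ₗ[ℂ] (U ⊗[ℂ] V) ⊗[ℂ] ℂ⸨X⸩ →ₗ[ℂ] (U ⊗[ℂ] V)⸨X⸩ :=
  LinearMap.mk₂ ℂ
    (fun u v' => TensorProduct.lift
      ((laurentMul (LinearMap.lsmul ℂ (U ⊗[ℂ] V)).flip).compl₁₂
        (TensorProduct.lift
          ((laurentMul (TensorProduct.mk ℂ U V)).compl₁₂ (A.Y u) (B.Y.flip v')))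
        negVar))
    (fun u₁ u₂ v' => by ext u'' v'' f; simp)
    (fun c u v' => by ext u'' v'' f; simp)
    (fun u v₁ v₂ => by ext u'' v'' f; simp)
    (fun c u v' => by ext u'' v'' f; simp)

/-- The vertex operator map of `U ⊗_R V`, `Y_R(x) = (Y(x) ⊗ Y(x)) R²³(-x)`: explicitly
`Y_R(u ⊗ v, x)(u' ⊗ v') = ∑ᵢ fᵢ(-x) Y(u, x) u'ᵢ ⊗ Y(vᵢ, x) v'` where
`R(x)(v ⊗ u') = ∑ᵢ u'ᵢ ⊗ vᵢ ⊗ fᵢ(x)`. -/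
def twistedY (A : VertexData U) (B : VertexData V)
    (R : V ⊗[ℂ] U →ₗ[ℂ] (U ⊗[ℂ] V) ⊗[ℂ] ℂ⸨X⸩) :
    U ⊗[ℂ] V →ₗ[ℂ] U ⊗[ℂ] V →ₗ[ℂ] (U ⊗[ℂ] V)⸨X⸩ :=
  TensorProduct.lift
    (LinearMap.mk₂ ℂ
      (fun u v => TensorProduct.lift
        (LinearMap.mk₂ ℂ (fun u' v' => twistedAux A B u v' (R (v ⊗ₜ u')))
          (fun _ _ _ => by simp [TensorProduct.tmul_add])
          (fun _ _ _ => by simp)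
          (fun _ _ _ => by simp)
          (fun _ _ _ => by simp)))
      (fun _ _ _ => by ext; simp)
      (fun _ _ _ => by ext; simp)
      (fun _ _ _ => by ext; simp [TensorProduct.add_tmul])
      (fun _ _ _ => by ext; simp [← TensorProduct.smul_tmul']))

/-- The twisted tensor product `U ⊗_R V`, with vacuum vector `𝟏 ⊗ 𝟏`. -/
def twistedTensor (A : VertexData U) (B : VertexData V)
    (R : V ⊗[ℂ] U →ₗ[ℂ] (U ⊗[ℂ] V) ⊗[ℂ] ℂ⸨X⸩) : VertexData (U ⊗[ℂ] V) where
  vac := A.vac ⊗ₜ B.vac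
  Y := twistedY A B R

end TwistingOperator

section Compatibility

variable {V₁ V₂ W : Type*} [AddCommGroup V₁] [Module ℂ V₁] [AddCommGroup V₂] [Module ℂ V₂]
  [AddCommGroup W] [Module ℂ W]

/-- The linear map `V₁ ⊗ V₂ → W` taking `v₁ ⊗ v₂` to the coefficient of `x ^ m * y ^ n` in
`Y₁(v₁, x) Y₂(v₂, y) w`. -/
def prodCoeff (Y₁ : V₁ →ₗ[ℂ] W →ₗ[ℂ] W⸨X⸩) (Y₂ : V₂ →ₗ[ℂ] W →ₗ[ℂ] W⸨X⸩) (w : W) (m n : ℤ) :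
    V₁ ⊗[ℂ] V₂ →ₗ[ℂ] W :=
  TensorProduct.lift
    (LinearMap.mk₂ ℂ (fun v₁ v₂ => mode Y₁ m v₁ (mode Y₂ n v₂ w))
      (fun _ _ _ => by simp) (fun _ _ _ => by simp) (fun _ _ _ => by simp) (fun _ _ _ => by simp))

/-- The formal series `Y₁(v₁, x₁) Y₂(v₂, x₂) w` in `x₁, x₂`. -/
def prodSeries (Y₁ : V₁ →ₗ[ℂ] W →ₗ[ℂ] W⸨X⸩) (Y₂ : V₂ →ₗ[ℂ] W →ₗ[ℂ] W⸨X⸩)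
    (v₁ : V₁) (v₂ : V₂) (w : W) : ℤ → ℤ → W :=
  fun m n => prodCoeff Y₁ Y₂ w m n (v₁ ⊗ₜ v₂)

/-- For `S(x) : V₁ ⊗ V₂ → V₂ ⊗ V₁ ⊗ ℂ((x))` and signs `ε, δ`, the formal series
`Y₂(x₂) (1 ⊗ Y₁(x₁)) S¹²(ε x₂ + δ x₁) (v₁ ⊗ v₂ ⊗ w)` in `x₁, x₂` (first index: power of `x₁`),
with powers of `ε x₂ + δ x₁` expanded in nonnegative powers of `x₁`. If
`S(x)(v₁ ⊗ v₂) = ∑ᵢ bᵢ ⊗ aᵢ ⊗ fᵢ(x)` this is `∑ᵢ fᵢ(ε x₂ + δ x₁) Y₂(bᵢ, x₂) Y₁(aᵢ, x₁) w`. -/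
def twistedSeries (Y₁ : V₁ →ₗ[ℂ] W →ₗ[ℂ] W⸨X⸩) (Y₂ : V₂ →ₗ[ℂ] W →ₗ[ℂ] W⸨X⸩)
    (S : V₁ ⊗[ℂ] V₂ →ₗ[ℂ] (V₂ ⊗[ℂ] V₁) ⊗[ℂ] ℂ⸨X⸩) (ε δ : ℤˣ)
    (v₁ : V₁) (v₂ : V₂) (w : W) : ℤ → ℤ → W :=
  fun p q => ∑ᶠ s : ℤ × ℕ, binomCoeff ε δ s.1 s.2 •
    prodCoeff Y₂ Y₁ w (q - (s.1 - s.2)) (p - s.2) (opCoeff S s.1 (v₁ ⊗ₜ v₂))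

end Compatibility

end TwistedTensor

end

/-! The proof recasts weak associativity as an operator product statement (`OperatorProduct`): if
`E(x, z)` is a product of two fields and `D(s, z)` the field of their product, then for some `k` the
series `(x - z)^k E(x, z)` has bounded poles in both variables, and putting `x = z + s` turns it
into `s^k D(s, z)`. For a module, any `k` bounding the pole of `Y(u, s)v` works, so `k` does not
depend on the vector `w` acted on.

Uniqueness: `Y_R(u ⊗ 𝟏, s)(𝟏 ⊗ v) = Y(u, s)𝟏 ⊗ v` has no pole, so `k = 0` is allowed, and the
constant term in `s` forces `Y(u ⊗ v, z)w` to be `YU(u, x) YV(v, z) w` at `x = z`.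

Existence: this diagonal field (`jointField`) must satisfy weak associativity. The product of two
such fields is the specialization `y = x`, `t = z` of `YU(u, x) YV(v, y) YU(u', z) YV(v', t) w`. If
`R(v ⊗ u') = ∑ bᵢ ⊗ aᵢ ⊗ fᵢ`, the third assumption, after multiplication by `(z - y)^k`, replaces
the middle pair by `∑ fᵢ(z - y) YU(bᵢ, z) YV(aᵢ, y)`. A further factor `(x - z)^α (y - t)^β` makes
every ordered product `YU YU YV YV` lie in `W((x, z, y, t))`. On the diagonal the factors combine to
`(x - z)^(α + β + k)` for even `k`. Substituting `x = z + s` then gives `fᵢ(-s)`, `Y(u, s)bᵢ` and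
`Y(aᵢ, s)v'`, exactly the ingredients of `Y_R` (`operatorProduct_jointField`).

The delicate point is that `(x - z)^α YU YU`, applied to all coefficients of `YV(v, y) YV(v', t) w`
at once, needs one common lower bound on exponents. The commutation relation with `R⁻¹` supplies it
(`UniformlyBounded.image_mode`): it moves the `U`-fields to the right of the `V`-fields, where they
act on the single vector `w`, with coefficients independent of `w` and only nonnegative shifts of
exponents. -/

noncomputable section

namespace TwistedTensor

set_option linter.unusedSectionVars false

/-! ### Binomial coefficients with integer lower index. -/

section Binomial

/-- The binomial coefficient `m choose p` for integers `m, p`, zero for negative `p`. -/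
def binomZ (m p : ℤ) : ℤ := if 0 ≤ p then Ring.choose m p.toNat else 0

theorem binomZ_natCast (m : ℤ) (p : ℕ) : binomZ m p = Ring.choose m p := by
  simp [binomZ]

theorem binomZ_of_neg (m : ℤ) {p : ℤ} (hp : p < 0) : binomZ m p = 0 := by
  simp [binomZ, hp]

theorem binomZ_zero_right (m : ℤ) : binomZ m 0 = 1 := by
  simp [binomZ]

theorem binomZ_eq_zero {m p : ℤ} (hm : 0 ≤ m) (h : m < p) : binomZ m p = 0 := by
  lift m to ℕ using hm
  lift p to ℕ using by omega
  rw [binomZ_natCast, Ring.choose_natCast, Nat.choose_eq_zero_of_lt (by omega)]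
  rfl

theorem binomZ_symm {m p : ℤ} (hm : 0 ≤ m) : binomZ m (m - p) = binomZ m p := by
  rcases lt_or_ge p 0 with hp | hp
  · rw [binomZ_of_neg m hp, binomZ_eq_zero hm (by omega)]
  rcases lt_or_ge m p with h | h
  · rw [binomZ_eq_zero hm h, binomZ_of_neg m (by omega)]
  lift m to ℕ using hm
  lift p to ℕ using hp
  rw [show (m : ℤ) - p = ((m - p : ℕ) : ℤ) by omega, binomZ_natCast, binomZ_natCast,
    Ring.choose_natCast, Ring.choose_natCast, Nat.choose_symm (by omega)]

theorem binomZ_succ (m p : ℤ) : binomZ (m + 1) p = binomZ m p + binomZ m (p - 1) := by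
  rcases lt_trichotomy p 0 with hp | rfl | hp
  · rw [binomZ_of_neg _ hp, binomZ_of_neg _ hp, binomZ_of_neg _ (by omega), add_zero]
  · rw [binomZ_zero_right, binomZ_zero_right, binomZ_of_neg _ (by omega), add_zero]
  · obtain ⟨k, rfl⟩ : ∃ k : ℕ, p = ((k + 1 : ℕ) : ℤ) := ⟨(p - 1).toNat, by omega⟩
    rw [show ((k + 1 : ℕ) : ℤ) - 1 = (k : ℤ) by push_cast; ring]
    simp only [binomZ_natCast]
    rw [Ring.choose_succ_succ, add_comm]

theorem binomZ_add (a b p : ℤ) :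
    binomZ (a + b) p = ∑ c ∈ Finset.Icc 0 p, binomZ a c * binomZ b (p - c) := by
  rcases lt_or_ge p 0 with hp | hp
  · rw [binomZ_of_neg _ hp, Finset.Icc_eq_empty (by omega), Finset.sum_empty]
  lift p to ℕ using hp
  rw [binomZ_natCast, Ring.add_choose_eq p (Commute.all a b)]
  refine Finset.sum_bij (fun ij _ => (ij.1 : ℤ)) ?_ ?_ ?_ ?_
  · intro ij h
    rw [Finset.HasAntidiagonal.mem_antidiagonal] at h
    rw [Finset.mem_Icc]
    omega
  · intro i hi j hj h
    rw [Finset.HasAntidiagonal.mem_antidiagonal] at hi hj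
    ext <;> omega
  · intro c hc
    rw [Finset.mem_Icc] at hc
    refine ⟨(c.toNat, p - c.toNat), ?_, ?_⟩
    · rw [Finset.HasAntidiagonal.mem_antidiagonal]; dsimp only; omega
    · dsimp only; omega
  · intro ij h
    rw [Finset.HasAntidiagonal.mem_antidiagonal] at h
    rw [show (p : ℤ) - ij.1 = (ij.2 : ℕ) by omega, binomZ_natCast, binomZ_natCast]

end Binomial

/-! ### Passing from sums over a half-line to sums over `ℤ`. -/

section Reindex

theorem finsum_natCast_add {M : Type*} [AddCommMonoid M] (f : ℤ → M) (p : ℤ)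
    (h : ∀ m < p, f m = 0) : ∑ᶠ j : ℕ, f (p + j) = ∑ᶠ m : ℤ, f m := by
  have hinj : Function.Injective (fun j : ℕ => p + (j : ℤ)) := fun a b h => by
    simpa using h
  have hs : Function.support f ⊆ Set.range (fun j : ℕ => p + (j : ℤ)) := by
    intro m hm
    refine ⟨(m - p).toNat, ?_⟩
    by_contra hc
    exact hm (h m (by dsimp only at hc; omega))
  rw [← finsum_mem_support f, ← Set.inter_eq_right.mpr hs, finsum_mem_inter_support,
    finsum_mem_range hinj]

end Reindex

/-! ### Substitutions `x ↦ x + y` in two variables, and the operator product form of weak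
associativity. -/

section Substitution

variable {W : Type*} [AddCommGroup W]

/-- Multiplication of a formal series in `x, y` by `x ^ a * y ^ b`. -/
def shift (a b : ℤ) (A : ℤ → ℤ → W) : ℤ → ℤ → W := fun m n => A (m - a) (n - b)

theorem mulLin_one_one_apply (A : ℤ → ℤ → W) (m n : ℤ) :
    mulLin 1 1 A m n = A (m - 1) n + A m (n - 1) := by simp [mulLin]

theorem mulLin_one_neg_apply (A : ℤ → ℤ → W) (m n : ℤ) :
    mulLin 1 (-1) A m n = A (m - 1) n - A m (n - 1) := by
  simp [mulLin, Units.neg_smul, sub_eq_add_neg]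

theorem mulLin_neg_one_apply (A : ℤ → ℤ → W) (m n : ℤ) :
    mulLin (-1) 1 A m n = A m (n - 1) - A (m - 1) n := by
  simp [mulLin, Units.neg_smul, sub_eq_add_neg, add_comm]

theorem mulLin_shift (ε δ : ℤˣ) (a b : ℤ) (A : ℤ → ℤ → W) :
    mulLin ε δ (shift a b A) = shift a b (mulLin ε δ A) := by
  ext m n
  simp only [mulLin, shift]
  rw [show m - 1 - a = m - a - 1 by ring, show n - 1 - b = n - b - 1 by ring]

theorem iterate_mulLin_shift (ε δ : ℤˣ) (k : ℕ) (a b : ℤ) (A : ℤ → ℤ → W) :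
    (mulLin ε δ)^[k] (shift a b A) = shift a b ((mulLin ε δ)^[k] A) := by
  induction k with
  | zero => rfl
  | succ k ih => rw [Function.iterate_succ_apply', ih, mulLin_shift, Function.iterate_succ_apply']

theorem shift_zero (A : ℤ → ℤ → W) : shift 0 0 A = A := by
  ext m n; simp [shift]

theorem shift_shift (a b a' b' : ℤ) (A : ℤ → ℤ → W) :
    shift a b (shift a' b' A) = shift (a + a') (b + b') A := by
  ext m n
  simp only [shift]
  congr 1 <;> ring

theorem iterate_mulLin_bound_fst (ε δ : ℤˣ) {A : ℤ → ℤ → W} {N : ℤ}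
    (hA : ∀ m n, m < N → A m n = 0) (k : ℕ) :
    ∀ m n, m < N → (mulLin ε δ)^[k] A m n = 0 := by
  induction k with
  | zero => exact hA
  | succ k ih =>
    intro m n h
    rw [Function.iterate_succ_apply', mulLin, ih _ _ h, ih _ _ (by omega)]
    simp

theorem iterate_mulLin_bound_snd (ε δ : ℤˣ) {A : ℤ → ℤ → W} {N : ℤ}
    (hA : ∀ m n, n < N → A m n = 0) (k : ℕ) :
    ∀ m n, n < N → (mulLin ε δ)^[k] A m n = 0 := by
  induction k with
  | zero => exact hA
  | succ k ih =>
    intro m n h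
    rw [Function.iterate_succ_apply', mulLin, ih _ _ h, ih _ _ (by omega)]
    simp

theorem IsLaurent₂.iterate_mulLin (ε δ : ℤˣ) {A : ℤ → ℤ → W} (hA : IsLaurent₂ A) (k : ℕ) :
    IsLaurent₂ ((mulLin ε δ)^[k] A) := by
  obtain ⟨N, hN⟩ := hA
  refine ⟨N, fun m n h => ?_⟩
  rcases h with h | h
  · exact iterate_mulLin_bound_fst ε δ (fun m n h => hN m n (Or.inl h)) k m n h
  · exact iterate_mulLin_bound_snd ε δ (fun m n h => hN m n (Or.inr h)) k m n h

/-- The homogeneous substitution with kernel `κ`: the coefficient of `x ^ p * y ^ q` is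
`∑ₘ κ m p • A m (p + q - m)`. -/
def kernelSub (κ : ℤ → ℤ → ℤ) (A : ℤ → ℤ → W) : ℤ → ℤ → W :=
  fun p q => ∑ᶠ m : ℤ, κ m p • A m (p + q - m)

/-- All sums defining `kernelSub κ A` are finite. -/
def KernelFinite (κ : ℤ → ℤ → ℤ) (A : ℤ → ℤ → W) : Prop :=
  ∀ p q, (Function.support fun m : ℤ => κ m p • A m (p + q - m)).Finite

/-- `κ m p` is the coefficient of `x ^ p * y ^ (m - p)` in an expansion of `(x + y) ^ m`. -/
def IsPascal (κ : ℤ → ℤ → ℤ) : Prop := ∀ m p, κ (m + 1) p = κ m p + κ m (p - 1)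

theorem KernelFinite.add {κ : ℤ → ℤ → ℤ} {A B : ℤ → ℤ → W} (hA : KernelFinite κ A)
    (hB : KernelFinite κ B) : KernelFinite κ (A + B) := fun p q =>
  ((hA p q).union (hB p q)).subset fun m hm => by
    by_contra h
    simp only [Set.mem_union, Function.mem_support, not_or, not_not] at h
    exact hm (by simp [smul_add, h.1, h.2])

theorem KernelFinite.neg {κ : ℤ → ℤ → ℤ} {A : ℤ → ℤ → W} (hA : KernelFinite κ A) :
    KernelFinite κ (-A) := fun p q => (hA p q).subset fun m hm => by
  simpa using hm

theorem KernelFinite.shift_fst {κ : ℤ → ℤ → ℤ} (hκ : IsPascal κ) {A : ℤ → ℤ → W}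
    (hA : KernelFinite κ A) : KernelFinite κ (shift 1 0 A) := fun p q => by
  refine (((hA p (q - 1)).union (hA (p - 1) q)).image (· + 1)).subset fun m hm => ?_
  refine ⟨m - 1, ?_, by simp⟩
  by_contra h
  simp only [Set.mem_union, Function.mem_support, not_or, not_not] at h
  refine hm ?_
  have h1 := hκ (m - 1) p
  rw [sub_add_cancel] at h1
  have h2 := h.1
  have h3 := h.2
  rw [show p + (q - 1) - (m - 1) = p + q - m by ring] at h2
  rw [show p - 1 + q - (m - 1) = p + q - m by ring] at h3
  simp [shift, h1, add_smul, h2, h3]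

theorem KernelFinite.shift_snd {κ : ℤ → ℤ → ℤ} {A : ℤ → ℤ → W}
    (hA : KernelFinite κ A) : KernelFinite κ (shift 0 1 A) := fun p q => by
  convert hA p (q - 1) using 3 with m
  simp only [shift]
  congr 2 <;> ring

theorem kernelSub_add {κ : ℤ → ℤ → ℤ} {A B : ℤ → ℤ → W} (hA : KernelFinite κ A)
    (hB : KernelFinite κ B) : kernelSub κ (A + B) = kernelSub κ A + kernelSub κ B := by
  ext p q
  simp only [kernelSub, Pi.add_apply, smul_add]
  exact finsum_add_distrib (hA p q) (hB p q)

theorem kernelSub_neg (κ : ℤ → ℤ → ℤ) (A : ℤ → ℤ → W) :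
    kernelSub κ (-A) = -kernelSub κ A := by
  ext p q
  simp only [kernelSub, Pi.neg_apply, smul_neg]
  exact finsum_neg_distrib _

theorem kernelSub_shift_snd (κ : ℤ → ℤ → ℤ) (A : ℤ → ℤ → W) :
    kernelSub κ (shift 0 1 A) = shift 0 1 (kernelSub κ A) := by
  ext p q
  simp only [kernelSub, shift, sub_zero]
  refine finsum_congr fun m => ?_
  congr 2; ring

/-- Pascal's rule is all that is needed here, so both expansions of the substitution, in powers of
`x` or of `y`, are treated at once. -/
theorem kernelSub_shift_fst {κ : ℤ → ℤ → ℤ} (hκ : IsPascal κ) {A : ℤ → ℤ → W}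
    (hA : KernelFinite κ A) : kernelSub κ (shift 1 0 A) = mulLin 1 1 (kernelSub κ A) := by
  ext p q
  rw [mulLin_one_one_apply]
  simp only [kernelSub, shift, sub_zero]
  rw [← finsum_comp_equiv (Equiv.addRight (1 : ℤ)),
    add_comm (∑ᶠ m : ℤ, κ m (p - 1) • A m (p - 1 + q - m)),
    ← finsum_add_distrib (hA p (q - 1)) (hA (p - 1) q)]
  refine finsum_congr fun m => ?_
  simp only [Equiv.coe_addRight, add_sub_cancel_right]
  rw [hκ, add_smul, show p + q - (m + 1) = p + (q - 1) - m by ring,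
    show p - 1 + q - m = p + (q - 1) - m by ring]

theorem mulLin_one_neg_eq (A : ℤ → ℤ → W) : mulLin 1 (-1) A = shift 1 0 A + -shift 0 1 A := by
  ext m n
  simp [mulLin_one_neg_apply, shift, sub_eq_add_neg]

theorem KernelFinite.mulLin {κ : ℤ → ℤ → ℤ} (hκ : IsPascal κ) {A : ℤ → ℤ → W}
    (hA : KernelFinite κ A) : KernelFinite κ (mulLin 1 (-1) A) := by
  rw [mulLin_one_neg_eq]
  exact (hA.shift_fst hκ).add hA.shift_snd.neg

/-- The substitution sends `x` to `x + y` and fixes `y`, hence sends the factor `x - y` to `x`. This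
is how a power of `x - y` becomes a power of `x₀`. -/
theorem kernelSub_mulLin {κ : ℤ → ℤ → ℤ} (hκ : IsPascal κ) {A : ℤ → ℤ → W}
    (hA : KernelFinite κ A) : kernelSub κ (mulLin 1 (-1) A) = shift 1 0 (kernelSub κ A) := by
  rw [mulLin_one_neg_eq, kernelSub_add (hA.shift_fst hκ) hA.shift_snd.neg, kernelSub_neg,
    kernelSub_shift_fst hκ hA, kernelSub_shift_snd]
  ext p q
  simp [mulLin_one_one_apply, shift]

theorem KernelFinite.iterate_mulLin {κ : ℤ → ℤ → ℤ} (hκ : IsPascal κ) {A : ℤ → ℤ → W}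
    (hA : KernelFinite κ A) (k : ℕ) : KernelFinite κ ((TwistedTensor.mulLin 1 (-1))^[k] A) := by
  induction k with
  | zero => exact hA
  | succ k ih => rw [Function.iterate_succ_apply']; exact ih.mulLin hκ

theorem kernelSub_iterate_mulLin {κ : ℤ → ℤ → ℤ} (hκ : IsPascal κ) {A : ℤ → ℤ → W}
    (hA : KernelFinite κ A) (k : ℕ) :
    kernelSub κ ((mulLin 1 (-1))^[k] A) = shift k 0 (kernelSub κ A) := by
  induction k with
  | zero => simp [shift_zero]
  | succ k ih =>
    rw [Function.iterate_succ_apply', kernelSub_mulLin hκ (hA.iterate_mulLin hκ k), ih, shift_shift]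
    push_cast
    rw [add_comm]

theorem KernelFinite.shift_natCast {κ : ℤ → ℤ → ℤ} (hκ : IsPascal κ) {A : ℤ → ℤ → W}
    (hA : KernelFinite κ A) (l : ℕ) : KernelFinite κ (shift l 0 A) := by
  induction l with
  | zero => simpa [shift_zero] using hA
  | succ l ih =>
    have := ih.shift_fst hκ
    rw [shift_shift] at this
    rwa [Nat.cast_succ, add_comm, ← add_zero (0 : ℤ)]

theorem kernelSub_shift_natCast {κ : ℤ → ℤ → ℤ} (hκ : IsPascal κ) {A : ℤ → ℤ → W}
    (hA : KernelFinite κ A) (l : ℕ) :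
    kernelSub κ (shift l 0 A) = (mulLin 1 1)^[l] (kernelSub κ A) := by
  induction l with
  | zero => simp [shift_zero]
  | succ l ih =>
    rw [Function.iterate_succ_apply', ← ih, ← kernelSub_shift_fst hκ (hA.shift_natCast hκ l),
      shift_shift, Nat.cast_succ, add_comm, add_zero]

/-- `A(x, y) ↦ A(x + y, y)`, expanded in nonnegative powers of `y`. -/
def expandSnd (A : ℤ → ℤ → W) : ℤ → ℤ → W := kernelSub (fun m p => binomZ m (m - p)) A

/-- `A(x, y) ↦ A(y + x, y)`, expanded in nonnegative powers of `x`. -/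
def expandFst (A : ℤ → ℤ → W) : ℤ → ℤ → W := kernelSub binomZ A

theorem isPascal_binomZ : IsPascal binomZ := binomZ_succ

theorem isPascal_binomZ_sub : IsPascal (fun m p => binomZ m (m - p)) := fun m p => by
  dsimp only
  rw [show m + 1 - p = m - p + 1 by ring, binomZ_succ, add_comm, show m - (p - 1) = m - p + 1 by ring,
    add_sub_cancel_right]

theorem IsLaurent₂.kernelFinite {A : ℤ → ℤ → W} (hA : IsLaurent₂ A) (κ : ℤ → ℤ → ℤ) :
    KernelFinite κ A := fun p q => by
  obtain ⟨N, hN⟩ := hA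
  refine (Set.finite_Icc N (p + q - N)).subset fun m hm => ?_
  by_contra h
  refine hm ?_
  dsimp only
  rw [hN _ _ (by rw [Set.mem_Icc] at h; omega), smul_zero]

theorem kernelFinite_binomZ_sub {A : ℤ → ℤ → W} {N : ℤ} (hN : ∀ m n, n < N → A m n = 0) :
    KernelFinite (fun m p => binomZ m (m - p)) A := fun p q => by
  refine (Set.finite_Icc p (p + q - N)).subset fun m hm => ?_
  by_contra h
  refine hm ?_
  dsimp only
  rcases lt_or_ge m p with h' | h'
  · rw [binomZ_of_neg _ (by omega), zero_smul]
  · rw [hN _ _ (by rw [Set.mem_Icc] at h; omega), smul_zero]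

/-- Nonnegative powers of `x + y` are polynomials, so the direction of expansion is irrelevant. -/
theorem expandSnd_eq_expandFst {A : ℤ → ℤ → W} (hA : ∀ m n, m < 0 → A m n = 0) :
    expandSnd A = expandFst A := by
  ext p q
  refine finsum_congr fun m => ?_
  rcases lt_or_ge m 0 with h | h
  · rw [hA _ _ h, smul_zero, smul_zero]
  · exact congrArg (· • _) (binomZ_symm h)

/-- The substitution is triangular in the power of `y`: for `m < 0`, the coefficient at `(m, n)` of
the expansion is `A m n` plus contributions of negative powers of `x` with smaller power of `y`,
since nonnegative powers of `x + y` produce no negative power of `x`. Induction on `n`, starting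
from the bound `N`, concludes. -/
theorem bound_fst_of_expandSnd {A : ℤ → ℤ → W} {N : ℤ} (hN : ∀ m n, n < N → A m n = 0)
    (h : ∀ p q, p < 0 → expandSnd A p q = 0) : ∀ m n, m < 0 → A m n = 0 := by
  suffices H : ∀ (d : ℕ) (m : ℤ), m < 0 → ∀ n : ℤ, n < N + d → A m n = 0 from fun m n hm =>
    H (n - N + 1).toNat m hm n (by omega)
  intro d
  induction d with
  | zero => exact fun m _ n hn => hN m n (by simpa using hn)
  | succ d ih =>
    intro m hm n hn
    rcases lt_or_ge n (N + d) with h' | h'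
    · exact ih m hm n h'
    have h1 := h m n hm
    rw [expandSnd, kernelSub, finsum_eq_single _ m] at h1
    · simpa [binomZ_zero_right] using h1
    · intro m' hm'
      rcases lt_or_ge m' m with h2 | h2
      · rw [binomZ_of_neg _ (by omega), zero_smul]
      rcases lt_or_ge m' 0 with h3 | h3
      · rw [ih m' h3 _ (by push_cast at hn; omega), smul_zero]
      · rw [binomZ_eq_zero h3 (by omega), zero_smul]

/-- Multiplication by `x + y` determines the coefficient at `(p, q)` from the product at `(p, q +
1)` and the coefficient at `(p - 1, q + 1)`; the lower bound on powers of `x` starts the induction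
on `p`. -/
theorem iterate_mulLin_one_one_injective {A B : ℤ → ℤ → W} {N : ℤ}
    (hA : ∀ p q, p < N → A p q = 0) (hB : ∀ p q, p < N → B p q = 0) (l : ℕ)
    (h : (mulLin 1 1)^[l] A = (mulLin 1 1)^[l] B) : A = B := by
  induction l with
  | zero => exact h
  | succ l ih =>
    apply ih
    rw [Function.iterate_succ_apply', Function.iterate_succ_apply'] at h
    have hA' := iterate_mulLin_bound_fst 1 1 hA l
    have hB' := iterate_mulLin_bound_fst 1 1 hB l
    set A' := (mulLin 1 1)^[l] A
    set B' := (mulLin 1 1)^[l] B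
    suffices H : ∀ (d : ℕ) (p : ℤ), p < N + d → ∀ q, A' p q = B' p q by
      ext p q
      exact H (p - N + 1).toNat p (by omega) q
    intro d
    induction d with
    | zero =>
      intro p hp q
      rw [hA' p q (by simpa using hp), hB' p q (by simpa using hp)]
    | succ d ihd =>
      intro p hp q
      have h1 := congrFun (congrFun h p) (q + 1)
      rw [mulLin_one_one_apply, mulLin_one_one_apply, ihd (p - 1) (by push_cast at hp; omega),
        add_sub_cancel_right] at h1
      exact add_left_cancel h1

/-- The operator product form of weak associativity: with `E(x, y)` the product of two fields and
`D(x, y)` the field of their product, `(x - y) ^ k * E(x, y)` lies in `W((x, y))`, and at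
`x = y + x₀` it becomes `x₀ ^ k * D(x₀, y)`. -/
def OperatorProduct (k : ℕ) (E D : ℤ → ℤ → W) : Prop :=
  IsLaurent₂ ((mulLin 1 (-1))^[k] E) ∧ shift k 0 D = expandFst ((mulLin 1 (-1))^[k] E)

/-- With `H = (x - y)^k E`, the hypothesis says that `x^l H` at `x = x₀ + y` equals `x₀^k (x₀ + y)^l
D`, which has no negative power of `x₀` because `k` bounds the pole of `D`. So `x^l H` has no
negative power of `x`, its two expansions agree, and `(x₀ + y)^l` can be cancelled. -/
theorem operatorProduct_of_iterate_eq {E D : ℤ → ℤ → W} {k l : ℕ} {N : ℤ}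
    (hE : ∀ m n, n < N → E m n = 0) (hD : ∀ p q, p < -(k : ℤ) → D p q = 0)
    (h : (mulLin 1 1)^[l] (expandSnd E) = (mulLin 1 1)^[l] D) : OperatorProduct k E D := by
  have hEfin := kernelFinite_binomZ_sub hE
  set H := (mulLin 1 (-1))^[k] E with hH
  have hHN : ∀ m n, n < N → H m n = 0 := iterate_mulLin_bound_snd 1 (-1) hE k
  have h1 : expandSnd (shift l 0 H) = shift k 0 ((mulLin 1 1)^[l] D) := by
    rw [← h, hH, expandSnd, kernelSub_shift_natCast isPascal_binomZ_sub
      (hEfin.iterate_mulLin isPascal_binomZ_sub k),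
      kernelSub_iterate_mulLin isPascal_binomZ_sub hEfin, iterate_mulLin_shift, expandSnd]
  have h2 : ∀ m n, m < 0 → shift l 0 H m n = 0 := by
    refine bound_fst_of_expandSnd (N := N) (fun m n hn => hHN _ _ (by simpa using hn)) ?_
    intro p q hp
    rw [h1, shift, iterate_mulLin_bound_fst 1 1 hD l _ _ (by omega)]
  have hL : IsLaurent₂ H := by
    refine ⟨min N (-l), fun m n hmn => ?_⟩
    rcases hmn with h3 | h3
    · have := h2 (m + l) n (by omega)
      simpa [shift] using this
    · exact hHN m n (by omega)
  refine ⟨hL, ?_⟩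
  obtain ⟨N', hN'⟩ := hL
  refine iterate_mulLin_one_one_injective (N := 0) (l := l) ?_ ?_ ?_
  · intro p q hp
    rw [shift, hD _ _ (by omega)]
  · intro p q hp
    refine finsum_eq_zero_of_forall_eq_zero fun m => ?_
    rw [binomZ_of_neg _ hp, zero_smul]
  · rw [iterate_mulLin_shift, ← h1, expandSnd_eq_expandFst h2, expandFst,
      kernelSub_shift_natCast isPascal_binomZ (IsLaurent₂.kernelFinite ⟨N', hN'⟩ _), expandFst]

/-- Taking `l` so large that `x^l H` has no negative power of `x` makes its two expansions agree;
the common factor `x₀^k` is a mere shift and is removed at the end. -/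
theorem OperatorProduct.exists_iterate_eq {E D : ℤ → ℤ → W} {k : ℕ} {N : ℤ}
    (hE : ∀ m n, n < N → E m n = 0) (h : OperatorProduct k E D) :
    ∃ l : ℕ, (mulLin 1 1)^[l] (expandSnd E) = (mulLin 1 1)^[l] D := by
  have hEfin := kernelFinite_binomZ_sub hE
  obtain ⟨hL, hT⟩ := h
  obtain ⟨N', hN'⟩ := id hL
  set H := (mulLin 1 (-1))^[k] E with hH
  set l := (-N').toNat
  have h2 : ∀ m n, m < 0 → shift l 0 H m n = 0 := fun m n hm => hN' _ _ (by omega)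
  have h3 := expandSnd_eq_expandFst h2
  rw [expandFst, kernelSub_shift_natCast isPascal_binomZ (hL.kernelFinite _), ← expandFst, ← hT,
    expandSnd, hH, kernelSub_shift_natCast isPascal_binomZ_sub
      (hEfin.iterate_mulLin isPascal_binomZ_sub k),
      kernelSub_iterate_mulLin isPascal_binomZ_sub hEfin, iterate_mulLin_shift,
      iterate_mulLin_shift] at h3
  refine ⟨l, ?_⟩
  ext p q
  have := congrFun (congrFun h3 (p + k)) q
  simpa [shift, expandSnd] using this

theorem OperatorProduct.succ {E D : ℤ → ℤ → W} {k : ℕ} (h : OperatorProduct k E D) :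
    OperatorProduct (k + 1) E D := by
  obtain ⟨hL, hT⟩ := h
  rw [OperatorProduct, Function.iterate_succ_apply']
  refine ⟨hL.iterate_mulLin 1 (-1) 1, ?_⟩
  rw [expandFst, kernelSub_mulLin isPascal_binomZ (hL.kernelFinite _), ← expandFst, ← hT,
    shift_shift, Nat.cast_succ, add_comm, add_zero]

theorem OperatorProduct.mono {E D : ℤ → ℤ → W} {k k' : ℕ} (h : OperatorProduct k E D)
    (hk : k ≤ k') : OperatorProduct k' E D := by
  induction k', hk using Nat.le_induction with
  | base => exact h
  | succ n _ ih => exact ih.succ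

end Substitution

/-! ### Weak associativity in operator product form. -/

section WeakAssoc

variable {V W : Type*} [AddCommGroup V] [Module ℂ V] [AddCommGroup W] [Module ℂ W]

/-- The coefficients of `YW(u, x) YW(v, y) w`. -/
def fieldProd (YW : V →ₗ[ℂ] W →ₗ[ℂ] W⸨X⸩) (u v : V) (w : W) : ℤ → ℤ → W :=
  fun m n => mode YW m u (mode YW n v w)

/-- The coefficients of `YW(Y(u, x) v, y) w`. -/
def prodField (Y : V →ₗ[ℂ] V →ₗ[ℂ] V⸨X⸩) (YW : V →ₗ[ℂ] W →ₗ[ℂ] W⸨X⸩) (u v : V) (w : W) :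
    ℤ → ℤ → W :=
  fun p q => mode YW q (mode Y p u v) w

theorem fieldProd_bound_snd (YW : V →ₗ[ℂ] W →ₗ[ℂ] W⸨X⸩) (u v : V) (w : W) :
    ∃ N : ℤ, ∀ m n, n < N → fieldProd YW u v w m n = 0 := by
  obtain ⟨N, hN⟩ := exists_coeff_eq_zero (YW v w)
  exact ⟨N, fun m n hn => by rw [fieldProd, mode_apply YW n, hN n hn, map_zero]⟩

theorem weakAssoc_iff (Y : V →ₗ[ℂ] V →ₗ[ℂ] V⸨X⸩) (YW : V →ₗ[ℂ] W →ₗ[ℂ] W⸨X⸩) (u v : V) (w : W) :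
    WeakAssoc Y YW u v w ↔ ∃ l : ℕ, (mulLin 1 1)^[l] (expandSnd (fieldProd YW u v w)) =
      (mulLin 1 1)^[l] (prodField Y YW u v w) := by
  have : (fun p q => ∑ᶠ j : ℕ, binomCoeff 1 1 (p + j) j •
      mode YW (p + j) u (mode YW (q - j) v w)) = expandSnd (fieldProd YW u v w) := by
    ext p q
    rw [expandSnd, kernelSub]
    rw [← finsum_natCast_add _ p fun m hm => by rw [binomZ_of_neg _ (by omega), zero_smul]]
    refine finsum_congr fun j => ?_
    simp only [fieldProd, add_sub_cancel_left, binomZ_natCast, binomCoeff]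
    rw [show p + q - (p + j) = q - j by ring]
    simp
  rw [WeakAssoc, this]
  rfl

/-- The exponent `k` is controlled by `u` and `v` alone, although the exponent in weak associativity
may depend on `w`. -/
theorem WeakAssoc.operatorProduct {Y : V →ₗ[ℂ] V →ₗ[ℂ] V⸨X⸩} {YW : V →ₗ[ℂ] W →ₗ[ℂ] W⸨X⸩}
    {u v : V} {w : W} (h : WeakAssoc Y YW u v w) {k : ℕ}
    (hk : ∀ n : ℤ, n < -(k : ℤ) → (Y u v).coeff n = 0) :
    OperatorProduct k (fieldProd YW u v w) (prodField Y YW u v w) := by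
  rw [weakAssoc_iff] at h
  obtain ⟨l, hl⟩ := h
  obtain ⟨N, hN⟩ := fieldProd_bound_snd YW u v w
  exact operatorProduct_of_iterate_eq hN
    (fun p q hp => by rw [prodField, mode_apply Y, hk p hp]; simp) hl

theorem weakAssoc_of_operatorProduct {Y : V →ₗ[ℂ] V →ₗ[ℂ] V⸨X⸩} {YW : V →ₗ[ℂ] W →ₗ[ℂ] W⸨X⸩}
    {u v : V} {w : W} {k : ℕ}
    (h : OperatorProduct k (fieldProd YW u v w) (prodField Y YW u v w)) :
    WeakAssoc Y YW u v w := by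
  obtain ⟨N, hN⟩ := fieldProd_bound_snd YW u v w
  rw [weakAssoc_iff]
  exact h.exists_iterate_eq hN

theorem exists_pole_bound (Y : V →ₗ[ℂ] V →ₗ[ℂ] V⸨X⸩) (u v : V) :
    ∃ k : ℕ, ∀ n : ℤ, n < -(k : ℤ) → (Y u v).coeff n = 0 := by
  obtain ⟨N, hN⟩ := exists_coeff_eq_zero (Y u v)
  exact ⟨(-N).toNat, fun n hn => hN n (by omega)⟩

end WeakAssoc

/-! ### Finiteness of supports. -/

section Finiteness

theorem finite_support_of_fibers {α β M : Type*} [Zero M] {f : α × β → M} {s : Set α}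
    (hs : s.Finite) (h0 : ∀ a ∉ s, ∀ b, f (a, b) = 0)
    (hf : ∀ a ∈ s, (Function.support fun b => f (a, b)).Finite) :
    (Function.support f).Finite := by
  refine (hs.biUnion fun a ha => (hf a ha).image (Prod.mk a)).subset ?_
  rintro ⟨a, b⟩ hab
  have ha : a ∈ s := by
    by_contra ha
    exact hab (h0 a ha b)
  exact Set.mem_biUnion ha ⟨b, hab, rfl⟩

theorem finite_support_map {α M N F : Type*} [Zero M] [Zero N] [FunLike F M N] [ZeroHomClass F M N]
    (g : α → F) {f : α → M} (hf : (Function.support f).Finite) :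
    (Function.support fun a => g a (f a)).Finite :=
  hf.subset fun a ha h => ha (by simp [h])

end Finiteness

/-! ### Writing the values of `R` as finite sums of pure tensors. -/

section Representation

variable {M N P : Type*} [AddCommGroup M] [Module ℂ M] [AddCommGroup N] [Module ℂ N]
  [AddCommGroup P] [Module ℂ P]

theorem exists_eq_sum_tmul_tmul (t : (M ⊗[ℂ] N) ⊗[ℂ] P) :
    ∃ (ι : Type) (_ : Fintype ι) (m : ι → M) (n : ι → N) (p : ι → P),
      t = ∑ i, (m i ⊗ₜ n i) ⊗ₜ p i := by
  induction t using TensorProduct.induction_on with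
  | zero => exact ⟨Empty, inferInstance, Empty.elim, Empty.elim, Empty.elim, by simp⟩
  | tmul s p =>
    induction s using TensorProduct.induction_on with
    | zero => exact ⟨Empty, inferInstance, Empty.elim, Empty.elim, Empty.elim, by simp⟩
    | tmul m n => exact ⟨Unit, inferInstance, fun _ => m, fun _ => n, fun _ => p, by simp⟩
    | add s s' hs hs' =>
      obtain ⟨ι, _, m, n, q, h⟩ := hs
      obtain ⟨ι', _, m', n', q', h'⟩ := hs'
      exact ⟨ι ⊕ ι', inferInstance, Sum.elim m m', Sum.elim n n', Sum.elim q q', by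
        rw [TensorProduct.add_tmul, h, h']; simp⟩
  | add s s' hs hs' =>
    obtain ⟨ι, _, m, n, q, h⟩ := hs
    obtain ⟨ι', _, m', n', q', h'⟩ := hs'
    exact ⟨ι ⊕ ι', inferInstance, Sum.elim m m', Sum.elim n n', Sum.elim q q', by
      rw [h, h']; simp⟩

variable {V₁ V₂ W : Type*} [AddCommGroup V₁] [Module ℂ V₁] [AddCommGroup V₂] [Module ℂ V₂]
  [AddCommGroup W] [Module ℂ W]

theorem opCoeff_of_eq_sum {S : P →ₗ[ℂ] (M ⊗[ℂ] N) ⊗[ℂ] ℂ⸨X⸩} {x : P} {ι : Type} [Fintype ι]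
    {m : ι → M} {n : ι → N} {f : ι → ℂ⸨X⸩} (h : S x = ∑ i, (m i ⊗ₜ n i) ⊗ₜ f i) (k : ℤ) :
    opCoeff S k x = ∑ i, (f i).coeff k • (m i ⊗ₜ[ℂ] n i) := by
  simp [opCoeff, h]

theorem prodCoeff_tmul (Y₁ : V₁ →ₗ[ℂ] W →ₗ[ℂ] W⸨X⸩) (Y₂ : V₂ →ₗ[ℂ] W →ₗ[ℂ] W⸨X⸩) (w : W) (m n : ℤ)
    (v₁ : V₁) (v₂ : V₂) :
    prodCoeff Y₁ Y₂ w m n (v₁ ⊗ₜ v₂) = mode Y₁ m v₁ (mode Y₂ n v₂ w) := rfl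

theorem twistedSeries_of_eq_sum (Y₁ : V₁ →ₗ[ℂ] W →ₗ[ℂ] W⸨X⸩) (Y₂ : V₂ →ₗ[ℂ] W →ₗ[ℂ] W⸨X⸩)
    {S : V₁ ⊗[ℂ] V₂ →ₗ[ℂ] (V₂ ⊗[ℂ] V₁) ⊗[ℂ] ℂ⸨X⸩} (ε δ : ℤˣ) {v₁ : V₁} {v₂ : V₂} {ι : Type}
    [Fintype ι] {b : ι → V₂} {a : ι → V₁} {f : ι → ℂ⸨X⸩}
    (h : S (v₁ ⊗ₜ v₂) = ∑ i, (b i ⊗ₜ a i) ⊗ₜ f i) (w : W) (p q : ℤ) :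
    twistedSeries Y₁ Y₂ S ε δ v₁ v₂ w p q = ∑ᶠ s : ℤ × ℕ, ∑ i, binomCoeff ε δ s.1 s.2 •
      (f i).coeff s.1 • mode Y₂ (q - (s.1 - s.2)) (b i) (mode Y₁ (p - s.2) (a i) w) := by
  refine finsum_congr fun s => ?_
  rw [opCoeff_of_eq_sum h, map_sum, Finset.smul_sum]
  refine Finset.sum_congr rfl fun i _ => ?_
  rw [map_smul, prodCoeff_tmul]

end Representation

/-! ### Multiplication by linear factors commutes with translations and locally finite sums. -/

section MulLin

variable {W W' : Type*} [AddCommGroup W] [AddCommGroup W']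

theorem iterate_mulLin_map {F : Type*} [FunLike F W W'] [AddMonoidHomClass F W W'] (f : F)
    (ε δ : ℤˣ) (A : ℤ → ℤ → W) (k : ℕ) :
    (mulLin ε δ)^[k] (fun m n => f (A m n)) = fun m n => f ((mulLin ε δ)^[k] A m n) := by
  induction k with
  | zero => rfl
  | succ k ih =>
    rw [Function.iterate_succ_apply', ih, Function.iterate_succ_apply']
    ext m n
    simp only [mulLin, Units.smul_def, map_add, map_zsmul]

/-- If `A` is a locally finite combination of translates of the series `B e`, then multiplying by
`ε x + δ y` on both sides preserves the relation. -/
theorem iterate_mulLin_of_translates {ι J : Type*} [Fintype ι] (ε δ : ℤˣ) {A : ℤ → ℤ → W'}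
    {B : ι → ℤ → ℤ → W} (K : ι → J → W →+ W') (a b : J → ℤ)
    (hfin : ∀ e m n, (Function.support fun j => B e (m - a j) (n - b j)).Finite)
    (h : ∀ m n, A m n = ∑ e, ∑ᶠ j, K e j (B e (m - a j) (n - b j))) (k : ℕ) :
    (∀ e m n, (Function.support fun j => (mulLin ε δ)^[k] (B e) (m - a j) (n - b j)).Finite) ∧
    ∀ m n, (mulLin ε δ)^[k] A m n =
      ∑ e, ∑ᶠ j, K e j ((mulLin ε δ)^[k] (B e) (m - a j) (n - b j)) := by
  induction k with
  | zero => exact ⟨hfin, h⟩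
  | succ k ih =>
    obtain ⟨ihf, ihs⟩ := ih
    simp only [Function.iterate_succ_apply']
    have e1 : ∀ m n (j : J), m - a j - 1 = m - 1 - a j ∧ n - b j - 1 = n - 1 - b j :=
      fun m n j => ⟨by ring, by ring⟩
    refine ⟨fun e m n => ((ihf e (m - 1) n).union (ihf e m (n - 1))).subset fun j hj => ?_,
      fun m n => ?_⟩
    · by_contra hc
      simp only [Set.mem_union, Function.mem_support, not_or, not_not] at hc
      refine hj ?_
      simp only [mulLin, (e1 m n j).1, (e1 m n j).2, hc.1, hc.2, smul_zero, add_zero]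
    · rw [mulLin, ihs, ihs, Units.smul_def, Units.smul_def, Finset.smul_sum, Finset.smul_sum,
        ← Finset.sum_add_distrib]
      refine Finset.sum_congr rfl fun e _ => ?_
      have hf1 := finite_support_map (K e) (ihf e (m - 1) n)
      have hf2 := finite_support_map (K e) (ihf e m (n - 1))
      rw [smul_finsum' _ hf1, smul_finsum' _ hf2]
      refine (finsum_add_distrib
        (hf1.subset (Function.support_const_smul_subset (ε : ℤ) _))
        (hf2.subset (Function.support_const_smul_subset (δ : ℤ) _))).symm.trans ?_
      refine finsum_congr fun j => ?_
      simp only [mulLin, (e1 m n j).1, (e1 m n j).2, Units.smul_def, map_add, map_zsmul]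
      rfl

end MulLin

/-! ### Moving `U`-fields past `V`-fields, and uniform pole bounds. -/

section Exchange

variable {U V W : Type*} [AddCommGroup U] [Module ℂ U] [AddCommGroup V] [Module ℂ V]
  [AddCommGroup W] [Module ℂ W]

/-- The action of a linear map on the coefficients of Laurent series. -/
def laurentMap (f : W →ₗ[ℂ] W) : W⸨X⸩ →ₗ[ℂ] W⸨X⸩ where
  toFun g := g.map f
  map_add' g h := by ext n; simp
  map_smul' c g := by ext n; simp

@[simp] theorem laurentMap_coeff (f : W →ₗ[ℂ] W) (g : W⸨X⸩) (n : ℤ) :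
    (laurentMap f g).coeff n = f (g.coeff n) := rfl

/-- The multiplication of `W((x))` by a scalar Laurent series. -/
def laurentSMul (c : ℂ⸨X⸩) : W⸨X⸩ →ₗ[ℂ] W⸨X⸩ := laurentMul (LinearMap.lsmul ℂ W) c

theorem laurentSMul_coeff (c : ℂ⸨X⸩) (g : W⸨X⸩) (n : ℤ) :
    (laurentSMul c g).coeff n = ∑ᶠ i : ℤ, c.coeff i • g.coeff (n - i) := rfl

theorem laurentMap_laurentSMul (f : W →ₗ[ℂ] W) (c : ℂ⸨X⸩) (g : W⸨X⸩) :
    laurentMap f (laurentSMul c g) = laurentSMul c (laurentMap f g) := by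
  ext n
  rw [laurentMap_coeff, laurentSMul_coeff, laurentSMul_coeff]
  refine (map_finsum f (finite_support_conv (LinearMap.lsmul ℂ W) c g n)).trans ?_
  exact finsum_congr fun i => map_smul _ _ _

theorem finite_support_mode (YU : U →ₗ[ℂ] W →ₗ[ℂ] W⸨X⸩) (u : U) (w : W) (m : ℤ) :
    (Function.support fun j : ℕ => mode YU (m - j) u w).Finite := by
  obtain ⟨N, hN⟩ := exists_coeff_eq_zero (YU u w)
  refine (Set.finite_Iic (m - N).toNat).subset fun j hj => ?_
  by_contra h
  rw [Set.mem_Iic] at h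
  exact hj (hN _ (by omega))

theorem finite_support_fieldProd (YU : U →ₗ[ℂ] W →ₗ[ℂ] W⸨X⸩) (u u' : U) (w : W) (m n : ℤ) :
    (Function.support fun j : ℕ × ℕ => fieldProd YU u u' w (m - j.2) (n - j.1)).Finite := by
  refine finite_support_of_fibers (finite_support_mode YU u' w n) (fun a ha b => ?_) fun a _ => ?_
  · rw [Function.mem_support, not_not] at ha
    simp [fieldProd, ha]
  · exact finite_support_mode YU u (mode YU (n - a) u' w) m

/-- The fields of `U` can be moved to the right of those of `V`. -/
def Exchange (YU : U →ₗ[ℂ] W →ₗ[ℂ] W⸨X⸩) (YV : V →ₗ[ℂ] W →ₗ[ℂ] W⸨X⸩) : Prop :=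
  ∀ (u : U) (v : V), ∃ (ι : Type) (_ : Fintype ι) (u' : ι → U) (v' : ι → V) (c : ι → ℕ → ℂ⸨X⸩),
    ∀ (w : W) (m : ℤ), laurentMap (mode YU m u) (YV v w) =
      ∑ i, ∑ᶠ j : ℕ, laurentSMul (c i j) (YV (v' i) (mode YU (m - j) (u' i) w))

theorem exchange_of_twistedSeries {YU : U →ₗ[ℂ] W →ₗ[ℂ] W⸨X⸩} {YV : V →ₗ[ℂ] W →ₗ[ℂ] W⸨X⸩}
    {S : U ⊗[ℂ] V →ₗ[ℂ] (V ⊗[ℂ] U) ⊗[ℂ] ℂ⸨X⸩} {ε δ : ℤˣ}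
    (hcomm : ∀ (u : U) (v : V) (w : W), prodSeries YU YV u v w = twistedSeries YU YV S ε δ u v w) :
    Exchange YU YV := by
  intro u v
  obtain ⟨ι, _, v', u', h, hS⟩ := exists_eq_sum_tmul_tmul (S (u ⊗ₜ v))
  -- The series indexed by `i, j` is the coefficient of `x₁ ^ j` in `hᵢ(ε x₂ + δ x₁)`; it does not
  -- involve `w`.
  refine ⟨ι, inferInstance, u', v', fun i j => HahnSeries.ofSuppBddBelow
    (fun e => binomCoeff ε δ (e + j) j • (h i).coeff (e + j)) ?_, fun w m => ?_⟩
  · obtain ⟨N, hN⟩ := exists_coeff_eq_zero (h i)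
    refine ⟨N - j, fun n hn => ?_⟩
    by_contra hlt
    exact hn (by dsimp only; rw [hN _ (by omega), smul_zero])
  · ext n
    have h1 : mode YU m u (mode YV n v w) = _ :=
      (congrFun (congrFun (hcomm u v w) m) n).trans
        (twistedSeries_of_eq_sum YU YV ε δ hS w m n)
    rw [laurentMap_coeff, ← mode_apply YV, h1]
    have key : ∀ i, (Function.support fun x : ℕ × ℤ => binomCoeff ε δ (x.2 + x.1) x.1 •
        (h i).coeff (x.2 + x.1) • mode YV (n - x.2) (v' i) (mode YU (m - x.1) (u' i) w)).Finite := by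
      intro i
      refine finite_support_of_fibers (finite_support_mode YU (u' i) w m) (fun a ha b => ?_)
        fun a _ => ?_
      · rw [Function.mem_support, not_not] at ha
        simp [ha]
      · obtain ⟨N, hN⟩ := exists_coeff_eq_zero (h i)
        obtain ⟨N', hN'⟩ := exists_coeff_eq_zero (YV (v' i) (mode YU (m - a) (u' i) w))
        refine (Set.finite_Icc (N - a) (n - N')).subset fun e he => ?_
        by_contra hc
        refine he ?_
        rw [Set.mem_Icc] at hc
        dsimp only
        rcases lt_or_ge e (N - a) with hlt | hge
        · rw [hN _ (by omega), zero_smul, smul_zero]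
        · rw [mode_apply YV, hN' _ (by omega), smul_zero, smul_zero]
    -- The index `s.1` is the total power of `ε x₂ + δ x₁`, while `e = s.1 - s.2` is the power of
    -- `x₂`.
    let eqv : ℕ × ℤ ≃ ℤ × ℕ :=
      { toFun := fun x => (x.2 + x.1, x.1)
        invFun := fun s => (s.2, s.1 - s.2)
        left_inv := fun x => by simp
        right_inv := fun s => by simp }
    rw [← finsum_comp_equiv eqv]
    simp only [eqv, Equiv.coe_fn_mk, add_sub_cancel_right]
    rw [finsum_sum_comm _ _ fun i _ => key i]
    rw [← coeffL_apply, map_sum]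
    refine Finset.sum_congr rfl fun i _ => ?_
    rw [finsum_curry _ (key i), map_finsum (coeffL n)]
    · refine finsum_congr fun j => ?_
      rw [coeffL_apply, laurentSMul_coeff]
      refine finsum_congr fun e => ?_
      rw [HahnSeries.coeff_ofSuppBddBelow, ← smul_assoc, mode_apply YV]
    · refine (finite_support_mode YU (u' i) w m).subset fun j hj hj0 => hj ?_
      dsimp only at hj0 ⊢
      rw [hj0, map_zero, map_zero]

/-- For all `u, u'` there are `a, N` such that `(x - y) ^ a YU(u, x) YU(u', y) w` vanishes below `N`
for all `w ∈ S`. -/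
def UniformlyBounded (YU : U →ₗ[ℂ] W →ₗ[ℂ] W⸨X⸩) (S : Set W) : Prop :=
  ∀ u u' : U, ∃ a₀ : ℕ, ∀ a ≥ a₀, ∃ N : ℤ, ∀ w ∈ S, ∀ m n, m < N ∨ n < N →
    (mulLin 1 (-1))^[a] (fieldProd YU u u' w) m n = 0

/-- For one vector this is the operator product property, with any exponent at least the pole order
of `Y(u, x)u'`. -/
theorem uniformlyBounded_singleton {A : VertexData U} {YU : U →ₗ[ℂ] W →ₗ[ℂ] W⸨X⸩}
    (hYU : A.IsModule YU) (w : W) : UniformlyBounded YU {w} := by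
  intro u u'
  obtain ⟨k, hk⟩ := exists_pole_bound A.Y u u'
  refine ⟨k, fun a ha => ?_⟩
  obtain ⟨N, hN⟩ := (((hYU.weakAssoc u u' w).operatorProduct hk).mono ha).1
  refine ⟨N, fun w' hw' => ?_⟩
  rw [Set.mem_singleton_iff] at hw'
  rw [hw']
  exact hN

/-- Exchanging `u'` and then `u` with `v` writes the product on a coefficient of `YV(v, ·)w` as a
locally finite combination of translates of finitely many products acting on `w`. Translations
commute with multiplication by `x - y` and have nonnegative exponents, so a lower bound valid on `S`
survives for every `w` in `S` and every `q`. -/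
theorem UniformlyBounded.image_mode {YU : U →ₗ[ℂ] W →ₗ[ℂ] W⸨X⸩} {YV : V →ₗ[ℂ] W →ₗ[ℂ] W⸨X⸩}
    (hex : Exchange YU YV) {S : Set W} (hS : UniformlyBounded YU S) (v : V) :
    UniformlyBounded YU {w' | ∃ w ∈ S, ∃ q : ℤ, w' = mode YV q v w} := by
  intro u u'
  obtain ⟨ι, _, u₁, v₁, c₁, h₁⟩ := hex u' v
  choose ι₂ inst₂ u₂ v₂ c₂ h₂ using fun i => hex u (v₁ i)
  choose a₀ ha₀ using fun e : Σ i, ι₂ i => hS (u₂ e.1 e.2) (u₁ e.1)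
  -- Only finitely many pairs of fields occur, so one exponent, and below one bound `N₀`, serve them
  -- all.
  refine ⟨Finset.univ.sup a₀, fun a ha => ?_⟩
  choose N hN using fun e => ha₀ e a ((Finset.le_sup (Finset.mem_univ e)).trans ha)
  obtain ⟨N₀, hN₀⟩ : ∃ N₀ : ℤ, ∀ e, N₀ ≤ N e := (Set.finite_range N).bddBelow.imp
    fun _ h e => h ⟨e, rfl⟩
  refine ⟨N₀, ?_⟩
  rintro _ ⟨w, hw, q, rfl⟩ m n hmn
  let K : (Σ i, ι₂ i) → ℕ × ℕ → W →+ W⸨X⸩ := fun e j =>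
    (laurentSMul (c₁ e.1 j.1) ∘ₗ laurentSMul (c₂ e.1 e.2 j.2) ∘ₗ YV (v₂ e.1 e.2)).toAddMonoidHom
  have hrel : ∀ m n, laurentMap (mode YU m u) (laurentMap (mode YU n u') (YV v w)) =
      ∑ e, ∑ᶠ j : ℕ × ℕ, K e j (fieldProd YU (u₂ e.1 e.2) (u₁ e.1) w (m - j.2) (n - j.1)) := by
    intro m n
    rw [h₁, map_sum, Fintype.sum_sigma]
    refine Finset.sum_congr rfl fun i _ => ?_
    have hf1 := finite_support_mode YU (u₁ i) w n
    refine (map_finsum (laurentMap (mode YU m u)) (finite_support_map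
      (fun j => laurentSMul (c₁ i j) ∘ₗ YV (v₁ i)) hf1)).trans ?_
    simp only [LinearMap.comp_apply]
    simp only [laurentMap_laurentSMul, h₂, map_sum]
    rw [finsum_sum_comm]
    · refine Finset.sum_congr rfl fun i' _ => ?_
      rw [finsum_curry _ (finite_support_map (K ⟨i, i'⟩) (finite_support_fieldProd YU _ _ w m n))]
      refine finsum_congr fun j => ?_
      exact map_finsum _ (finite_support_map (fun j' => laurentSMul (c₂ i i' j') ∘ₗ YV (v₂ i i'))
        (finite_support_mode YU (u₂ i i') _ m))
    · intro i' _
      refine hf1.subset fun j hj hj0 => hj ?_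
      dsimp only at hj0 ⊢
      rw [hj0]
      simp
  have hmul := (iterate_mulLin_of_translates 1 (-1) K (fun j => (j.2 : ℤ)) (fun j => (j.1 : ℤ))
    (fun e m n => finite_support_fieldProd YU _ _ w m n) hrel a).2 m n
  have hco : fieldProd YU u u' (mode YV q v w) = fun m n => coeffL q
    (laurentMap (mode YU m u) (laurentMap (mode YU n u') (YV v w))) := rfl
  rw [hco, iterate_mulLin_map]
  dsimp only
  rw [hmul, Finset.sum_eq_zero, map_zero]
  intro e _
  refine finsum_eq_zero_of_forall_eq_zero fun j => ?_
  rw [hN e w hw _ _ (by have := hN₀ e; omega), map_zero]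

end Exchange

/-! ### Integral powers of `y - x` and the expansion of `R(y - x)`. -/

section PowSeries

variable {W : Type*} [AddCommGroup W] [Module ℂ W]

/-- Multiplication by `(y - x) ^ s`, expanded in nonnegative powers of `x`. -/
def mulPow (s : ℤ) (C : ℤ → ℤ → W) : ℤ → ℤ → W :=
  fun p q => ∑ᶠ j : ℤ, (Int.negOnePow j : ℤ) • binomZ s j • C (p - j) (q - s + j)

theorem IsLaurent₂.finite_support_mulPow {C : ℤ → ℤ → W} (hC : IsLaurent₂ C) (s p q : ℤ) :
    (Function.support fun j : ℤ =>
      (Int.negOnePow j : ℤ) • binomZ s j • C (p - j) (q - s + j)).Finite := by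
  obtain ⟨N, hN⟩ := hC
  refine (Set.finite_Icc (N + s - q) (p - N)).subset fun j hj => ?_
  by_contra h
  rw [Set.mem_Icc] at h
  exact hj (by dsimp only; rw [hN _ _ (by omega), smul_zero, smul_zero])

theorem IsLaurent₂.mulPow_eq_zero {C : ℤ → ℤ → W} {N : ℤ}
    (hN : ∀ m n, m < N ∨ n < N → C m n = 0) {s p q : ℤ} (h : p + q < 2 * N + s) :
    mulPow s C p q = 0 := by
  refine finsum_eq_zero_of_forall_eq_zero fun j => ?_
  rw [hN _ _ (by omega), smul_zero, smul_zero]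

theorem mulPow_zero (C : ℤ → ℤ → W) : mulPow 0 C = C := by
  ext p q
  rw [mulPow, finsum_eq_single _ 0]
  · simp [binomZ_zero_right]
  · intro j hj
    rcases lt_or_gt_of_ne hj with h | h
    · rw [binomZ_of_neg _ h, zero_smul, smul_zero]
    · rw [binomZ_eq_zero le_rfl h, zero_smul, smul_zero]

theorem mulLin_mulPow {C : ℤ → ℤ → W} (hC : IsLaurent₂ C) (s : ℤ) :
    mulLin (-1) 1 (mulPow s C) = mulPow (s + 1) C := by
  ext p q
  rw [mulLin_neg_one_apply]
  simp only [mulPow]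
  rw [← finsum_comp_equiv (Equiv.subRight (1 : ℤ)) (f := fun j : ℤ =>
    (Int.negOnePow j : ℤ) • binomZ s j • C (p - 1 - j) (q - s + j)), ← finsum_sub_distrib
      (hC.finite_support_mulPow s p (q - 1))
      (by
        have := (hC.finite_support_mulPow s (p - 1) q).image (Equiv.addRight (1 : ℤ))
        refine this.subset fun j hj => ⟨j - 1, hj, by simp⟩)]
  refine finsum_congr fun j => ?_
  simp only [Equiv.subRight_apply]
  rw [binomZ_succ, add_smul, smul_add, Int.negOnePow_sub, show p - 1 - (j - 1) = p - j by ring,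
    show q - s + (j - 1) = q - (s + 1) + j by ring, show q - 1 - s + j = q - (s + 1) + j by ring]
  simp [sub_eq_add_neg]

theorem iterate_mulLin_mulPow {C : ℤ → ℤ → W} (hC : IsLaurent₂ C) (s : ℤ) (k : ℕ) :
    (mulLin (-1) 1)^[k] (mulPow s C) = mulPow (s + k) C := by
  induction k with
  | zero => simp
  | succ k ih =>
    rw [Function.iterate_succ_apply', ih, mulLin_mulPow hC, Nat.cast_succ, add_assoc]

theorem iterate_mulLin_eq_mulPow {C : ℤ → ℤ → W} (hC : IsLaurent₂ C) (k : ℕ) :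
    (mulLin (-1) 1)^[k] C = mulPow k C := by
  conv_lhs => rw [← mulPow_zero C, iterate_mulLin_mulPow hC, zero_add]

/-- Multiplication by `(ε x + δ y) ^ k` commutes with locally finite sums. -/
theorem iterate_mulLin_finsum {ι J : Type*} [Fintype ι] (ε δ : ℤˣ) {A : ℤ → ℤ → W}
    {B : ι → J → ℤ → ℤ → W}
    (hfin : ∀ e m n, (Function.support fun j => B e j m n).Finite)
    (h : ∀ m n, A m n = ∑ e, ∑ᶠ j, B e j m n) (k : ℕ) :
    (∀ e m n, (Function.support fun j => (mulLin ε δ)^[k] (B e j) m n).Finite) ∧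
    ∀ m n, (mulLin ε δ)^[k] A m n = ∑ e, ∑ᶠ j, (mulLin ε δ)^[k] (B e j) m n := by
  induction k with
  | zero => exact ⟨hfin, h⟩
  | succ k ih =>
    obtain ⟨ihf, ihs⟩ := ih
    simp only [Function.iterate_succ_apply']
    refine ⟨fun e m n => ((ihf e (m - 1) n).union (ihf e m (n - 1))).subset fun j hj => ?_,
      fun m n => ?_⟩
    · by_contra hc
      simp only [Set.mem_union, Function.mem_support, not_or, not_not] at hc
      refine hj ?_
      simp only [mulLin, hc.1, hc.2, smul_zero, add_zero]
    · rw [mulLin, ihs, ihs, Units.smul_def, Units.smul_def, Finset.smul_sum, Finset.smul_sum,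
        ← Finset.sum_add_distrib]
      refine Finset.sum_congr rfl fun e _ => ?_
      have hf1 := ihf e (m - 1) n
      have hf2 := ihf e m (n - 1)
      rw [smul_finsum' _ hf1, smul_finsum' _ hf2]
      refine (finsum_add_distrib
        (hf1.subset (Function.support_const_smul_subset (ε : ℤ) _))
        (hf2.subset (Function.support_const_smul_subset (δ : ℤ) _))).symm.trans ?_
      refine finsum_congr fun j => ?_
      simp only [mulLin, Units.smul_def]
      rfl

variable {V₁ V₂ : Type*} [AddCommGroup V₁] [Module ℂ V₁] [AddCommGroup V₂] [Module ℂ V₂]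

/-- After multiplication by `(y - x) ^ k`, the expansion of `S(y - x)` involves only nonnegative
powers of `y - x`. -/
theorem iterate_mulLin_twistedSeries (Y₁ : V₁ →ₗ[ℂ] W →ₗ[ℂ] W⸨X⸩) (Y₂ : V₂ →ₗ[ℂ] W →ₗ[ℂ] W⸨X⸩)
    {S : V₁ ⊗[ℂ] V₂ →ₗ[ℂ] (V₂ ⊗[ℂ] V₁) ⊗[ℂ] ℂ⸨X⸩} {v₁ : V₁} {v₂ : V₂} {ι : Type}
    [Fintype ι] {b : ι → V₂} {a : ι → V₁} {f : ι → ℂ⸨X⸩}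
    (h : S (v₁ ⊗ₜ v₂) = ∑ i, (b i ⊗ₜ a i) ⊗ₜ f i) {w : W} {k : ℕ}
    (hk : ∀ i, ∀ n : ℤ, n < -(k : ℤ) → (f i).coeff n = 0)
    (hC : ∀ i, IsLaurent₂ fun p q => mode Y₂ q (b i) (mode Y₁ p (a i) w)) (p q : ℤ) :
    (∀ i, (Function.support fun r : ℕ => (f i).coeff (r - k) •
      (mulLin (-1) 1)^[r] (fun p q => mode Y₂ q (b i) (mode Y₁ p (a i) w)) p q).Finite) ∧
    (mulLin (-1) 1)^[k] (twistedSeries Y₁ Y₂ S 1 (-1) v₁ v₂ w) p q =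
      ∑ i, ∑ᶠ r : ℕ, (f i).coeff (r - k) •
        (mulLin (-1) 1)^[r] (fun p q => mode Y₂ q (b i) (mode Y₁ p (a i) w)) p q := by
  set C : ι → ℤ → ℤ → W := fun i p q => mode Y₂ q (b i) (mode Y₁ p (a i) w) with hCdef
  have hfin : ∀ i p q, (Function.support fun s : ℤ => (f i).coeff s • mulPow s (C i) p q).Finite := by
    intro i p q
    obtain ⟨N, hN⟩ := hC i
    refine (Set.finite_Icc (-(k : ℤ)) (p + q - 2 * N)).subset fun s hs => ?_
    by_contra hc
    rw [Set.mem_Icc] at hc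
    refine hs ?_
    dsimp only
    rcases lt_or_ge s (-(k : ℤ)) with hlt | hge
    · rw [hk i s hlt, zero_smul]
    · rw [IsLaurent₂.mulPow_eq_zero hN (by omega), smul_zero]
  have hsum : ∀ p q, twistedSeries Y₁ Y₂ S 1 (-1) v₁ v₂ w p q =
      ∑ i, ∑ᶠ s : ℤ, (f i).coeff s • mulPow s (C i) p q := by
    intro p q
    rw [twistedSeries_of_eq_sum Y₁ Y₂ 1 (-1) h]
    have key : ∀ i, (Function.support fun s : ℤ × ℕ => binomCoeff 1 (-1) s.1 s.2 •
        (f i).coeff s.1 • mode Y₂ (q - (s.1 - s.2)) (b i) (mode Y₁ (p - s.2) (a i) w)).Finite := by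
      intro i
      obtain ⟨N, hN⟩ := hC i
      refine ((Set.finite_Icc (-(k : ℤ)) (p + q - 2 * N)).prod
        (Set.finite_Iic (p - N).toNat)).subset fun s hs => ?_
      by_contra hc
      rw [Set.mem_prod, Set.mem_Icc, Set.mem_Iic] at hc
      refine hs ?_
      dsimp only
      rcases lt_or_ge s.1 (-(k : ℤ)) with hlt | hge
      · rw [hk i s.1 hlt, zero_smul, smul_zero]
      · have : C i (p - s.2) (q - (s.1 - s.2)) = 0 := hN _ _ (by omega)
        simp only [hCdef] at this
        rw [this, smul_zero, smul_zero]
    rw [finsum_sum_comm _ _ fun i _ => key i]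
    refine Finset.sum_congr rfl fun i _ => ?_
    rw [finsum_curry _ (key i)]
    refine finsum_congr fun s => ?_
    rw [mulPow, ← finsum_natCast_add _ 0 fun j hj => by
      rw [binomZ_of_neg _ hj, zero_smul, smul_zero], smul_finsum']
    · refine finsum_congr fun j => ?_
      simp only [zero_add, binomZ_natCast, hCdef]
      rw [smul_comm, smul_smul]
      congr 3
      · simp [binomCoeff, Int.negOnePow]
      · ring_nf
    · have := (hC i).finite_support_mulPow s p q
      exact (this.preimage (f := fun j : ℕ => (0 : ℤ) + j) (fun a _ b _ h => by simpa using h))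
  have hmul := iterate_mulLin_finsum (-1) 1 hfin hsum k
  have hterm : ∀ i s p q, (mulLin (-1) 1)^[k] (fun p q => (f i).coeff s • mulPow s (C i) p q) p q =
      (f i).coeff s • mulPow (s + k) (C i) p q := by
    intro i s p q
    rw [← iterate_mulLin_mulPow (hC i)]
    exact congrFun (congrFun (iterate_mulLin_map (LinearMap.lsmul ℂ W ((f i).coeff s)) (-1) 1
      (mulPow s (C i)) k) p) q
  have hpow : ∀ i (r : ℕ), (mulLin (-1) 1)^[r] (fun p q => mode Y₂ q (b i) (mode Y₁ p (a i) w)) =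
      mulPow r (C i) := fun i r =>
    iterate_mulLin_eq_mulPow (hC i) r
  simp only [hpow]
  -- Reindexing by `r = s + k`: since `-k` bounds the pole of every `f i`, the surviving exponents
  -- `r` of `y - x` are nonnegative.
  have hshift : ∀ i, (fun r : ℕ => (f i).coeff (r - k) • mulPow r (C i) p q) =
      (fun s : ℤ => (f i).coeff s • mulPow (s + k) (C i) p q) ∘ fun r : ℕ => -(k : ℤ) + r := by
    intro i
    ext r
    simp only [Function.comp_apply]
    rw [show -(k : ℤ) + r = r - k by ring, sub_add_cancel]
  constructor
  · intro i
    rw [hshift]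
    have := hmul.1 i p q
    simp only [hterm] at this
    exact this.preimage fun a _ b _ h => by simpa using h
  · rw [hmul.2]
    refine Finset.sum_congr rfl fun i _ => ?_
    simp only [hterm]
    rw [← finsum_natCast_add _ (-(k : ℤ)) fun s hs => by rw [hk i s hs, zero_smul]]
    exact finsum_congr fun r => (congrFun (hshift i) r).symm

end PowSeries

/-! ### Series in four variables and their restriction to the diagonal `y = x`, `t = z`. -/

section FourVariables

variable {W : Type*} [AddCommGroup W] [Module ℂ W]

/-- Exponents of monomials in four variables `x, z, y, t`. -/
abbrev Exp₄ := ℤ × ℤ × ℤ × ℤ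

/-- Multiplication of a formal series by the difference of the monomials with exponents `g` and
`h`. -/
def mulDiff (g h : Exp₄) (F : Exp₄ → W) : Exp₄ → W := fun e => F (e - g) - F (e - h)

theorem mulDiff_commute (g h g' h' : Exp₄) :
    Function.Commute (mulDiff (W := W) g h) (mulDiff g' h') := fun F => by
  ext e
  simp only [mulDiff]
  rw [sub_right_comm e g' g, sub_right_comm e g' h, sub_right_comm e h' g, sub_right_comm e h' h]
  abel

theorem iterate_mulDiff_map {W' F : Type*} [AddCommGroup W'] [FunLike F W W']
    [AddMonoidHomClass F W W'] (f : F) (g h : Exp₄) (A : Exp₄ → W) (k : ℕ) :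
    (mulDiff g h)^[k] (fun e => f (A e)) = fun e => f ((mulDiff g h)^[k] A e) := by
  induction k with
  | zero => rfl
  | succ k ih =>
    rw [Function.iterate_succ_apply', ih, Function.iterate_succ_apply']
    ext e
    simp only [mulDiff, map_sub]

theorem iterate_mulDiff_finsum {ι J : Type*} [Fintype ι] (g h : Exp₄) {A : Exp₄ → W}
    {B : ι → J → Exp₄ → W} (hfin : ∀ i e, (Function.support fun j => B i j e).Finite)
    (hA : ∀ e, A e = ∑ i, ∑ᶠ j, B i j e) (k : ℕ) :
    (∀ i e, (Function.support fun j => (mulDiff g h)^[k] (B i j) e).Finite) ∧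
    ∀ e, (mulDiff g h)^[k] A e = ∑ i, ∑ᶠ j, (mulDiff g h)^[k] (B i j) e := by
  induction k with
  | zero => exact ⟨hfin, hA⟩
  | succ k ih =>
    obtain ⟨ihf, ihs⟩ := ih
    simp only [Function.iterate_succ_apply']
    refine ⟨fun i e => ((ihf i (e - g)).union (ihf i (e - h))).subset fun j hj => ?_, fun e => ?_⟩
    · by_contra hc
      simp only [Set.mem_union, Function.mem_support, not_or, not_not] at hc
      refine hj ?_
      simp only [mulDiff, hc.1, hc.2, sub_zero]
    · rw [mulDiff, ihs, ihs, ← Finset.sum_sub_distrib]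
      refine Finset.sum_congr rfl fun i _ => ?_
      exact (finsum_sub_distrib (ihf i (e - g)) (ihf i (e - h))).symm

/-- `F` lies in `W((x, z, y, t))`, with all exponents at least `N`. -/
def BoundedBelow (N : ℤ) (F : Exp₄ → W) : Prop :=
  ∀ e : Exp₄, (e.1 < N ∨ e.2.1 < N ∨ e.2.2.1 < N ∨ e.2.2.2 < N) → F e = 0

/-- The total degree. -/
def totalDeg (e : Exp₄) : ℤ := e.1 + e.2.1 + e.2.2.1 + e.2.2.2

theorem BoundedBelow.iterate_mulDiff {g h : Exp₄} (hg : 0 ≤ g) (hh : 0 ≤ h) {N : ℤ} {F : Exp₄ → W}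
    (hF : BoundedBelow N F) (k : ℕ) : BoundedBelow N ((mulDiff g h)^[k] F) := by
  induction k with
  | zero => exact hF
  | succ k ih =>
    intro e he
    simp only [Prod.le_def] at hg hh
    simp only [Prod.fst_zero, Prod.snd_zero] at hg hh
    rw [Function.iterate_succ_apply', mulDiff, ih, ih, sub_zero]
    all_goals
      simp only [Prod.fst_sub, Prod.snd_sub]
      omega

/-- All monomials of `F` have total degree at least `4 * N`, and each factor raises the degree by
one. Hence in a fixed degree only finitely many powers contribute, which truncates the expansion of
`fᵢ(z - y)`. -/
theorem BoundedBelow.iterate_mulDiff_eq_zero {g h : Exp₄} (hg : totalDeg g = 1)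
    (hh : totalDeg h = 1) {N : ℤ} {F : Exp₄ → W} (hF : BoundedBelow N F) (k : ℕ) :
    ∀ e, totalDeg e < 4 * N + k → (mulDiff g h)^[k] F e = 0 := by
  induction k with
  | zero =>
    intro e he
    refine hF e ?_
    simp only [totalDeg] at he
    omega
  | succ k ih =>
    intro e he
    simp only [totalDeg] at hg hh he
    rw [Function.iterate_succ_apply', mulDiff, ih, ih, sub_zero]
    all_goals
      simp only [totalDeg, Prod.fst_sub, Prod.snd_sub]
      push_cast at he
      omega

/-- The specialization `y = x`, `t = z`. -/
def diag (F : Exp₄ → W) : ℤ → ℤ → W := fun m n => ∑ᶠ s : ℤ × ℤ, F (s.1, s.2, m - s.1, n - s.2)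

/-- All sums defining `diag F` are finite. -/
def DiagFinite (F : Exp₄ → W) : Prop :=
  ∀ m n : ℤ, (Function.support fun s : ℤ × ℤ => F (s.1, s.2, m - s.1, n - s.2)).Finite

theorem diagFinite_translate {F : Exp₄ → W} (hF : DiagFinite F) (g : Exp₄) :
    DiagFinite fun e => F (e - g) := fun m n => by
  refine ((hF (m - g.1 - g.2.2.1) (n - g.2.1 - g.2.2.2)).image
    (Equiv.addRight ((g.1, g.2.1) : ℤ × ℤ))).subset fun s hs => ?_
  refine ⟨s - (g.1, g.2.1), ?_, by simp⟩
  rw [Function.mem_support] at hs ⊢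
  convert hs using 2
  simp only [Prod.ext_iff, Prod.fst_sub, Prod.snd_sub, true_and]
  constructor <;> ring

theorem diag_translate (F : Exp₄ → W) (g : Exp₄) :
    diag (fun e => F (e - g)) = shift (g.1 + g.2.2.1) (g.2.1 + g.2.2.2) (diag F) := by
  ext m n
  simp only [diag, shift]
  rw [← finsum_comp_equiv (Equiv.addRight ((g.1, g.2.1) : ℤ × ℤ))]
  refine finsum_congr fun s => ?_
  congr 1
  simp only [Equiv.coe_addRight, Prod.ext_iff, Prod.fst_sub, Prod.snd_sub, Prod.fst_add,
    Prod.snd_add, add_sub_cancel_right, true_and]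
  constructor <;> ring

theorem DiagFinite.iterate_mulDiff {F : Exp₄ → W} (hF : DiagFinite F) (g h : Exp₄) (k : ℕ) :
    DiagFinite ((mulDiff g h)^[k] F) := by
  induction k with
  | zero => exact hF
  | succ k ih =>
    rw [Function.iterate_succ_apply']
    intro m n
    refine ((diagFinite_translate ih g m n).union (diagFinite_translate ih h m n)).subset
      fun s hs => ?_
    by_contra hc
    simp only [Set.mem_union, Function.mem_support, not_or, not_not] at hc
    exact hs (by simp only [mulDiff, hc.1, hc.2, sub_zero])

theorem diag_mulDiff {F : Exp₄ → W} (hF : DiagFinite F) (g h : Exp₄) :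
    diag (mulDiff g h F) = shift (g.1 + g.2.2.1) (g.2.1 + g.2.2.2) (diag F) -
      shift (h.1 + h.2.2.1) (h.2.1 + h.2.2.2) (diag F) := by
  rw [← diag_translate, ← diag_translate]
  ext m n
  exact finsum_sub_distrib (diagFinite_translate hF g m n) (diagFinite_translate hF h m n)

theorem diag_iterate_mulDiff {F : Exp₄ → W} (hF : DiagFinite F) {g h : Exp₄}
    (hg : g.1 + g.2.2.1 = 1) (hg' : g.2.1 + g.2.2.2 = 0)
    (hh : h.1 + h.2.2.1 = 0) (hh' : h.2.1 + h.2.2.2 = 1) (k : ℕ) :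
    diag ((mulDiff g h)^[k] F) = (mulLin 1 (-1))^[k] (diag F) := by
  induction k with
  | zero => rfl
  | succ k ih =>
    rw [Function.iterate_succ_apply', diag_mulDiff (hF.iterate_mulDiff g h k), hg, hg', hh, hh', ih,
      Function.iterate_succ_apply', mulLin_one_neg_eq, sub_eq_add_neg]

theorem mulLin_neg_one_eq {W : Type*} [AddCommGroup W] (A : ℤ → ℤ → W) :
    mulLin (-1) 1 A = shift 0 1 A + -shift 1 0 A := by
  ext m n
  simp [mulLin_neg_one_apply, shift, sub_eq_add_neg]

theorem diag_iterate_mulDiff' {F : Exp₄ → W} (hF : DiagFinite F) {g h : Exp₄}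
    (hg : g.1 + g.2.2.1 = 0) (hg' : g.2.1 + g.2.2.2 = 1)
    (hh : h.1 + h.2.2.1 = 1) (hh' : h.2.1 + h.2.2.2 = 0) (k : ℕ) :
    diag ((mulDiff g h)^[k] F) = (mulLin (-1) 1)^[k] (diag F) := by
  induction k with
  | zero => rfl
  | succ k ih =>
    rw [Function.iterate_succ_apply', diag_mulDiff (hF.iterate_mulDiff g h k), hg, hg', hh, hh', ih,
      Function.iterate_succ_apply', mulLin_neg_one_eq, sub_eq_add_neg]

theorem BoundedBelow.diagFinite {N : ℤ} {F : Exp₄ → W} (hF : BoundedBelow N F) :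
    DiagFinite F := fun m n => by
  refine ((Set.finite_Icc N (m - N)).prod (Set.finite_Icc N (n - N))).subset fun s hs => ?_
  by_contra h
  rw [Set.mem_prod, Set.mem_Icc, Set.mem_Icc] at h
  exact hs (hF _ (by dsimp only; omega))

theorem BoundedBelow.isLaurent₂_diag {N : ℤ} {F : Exp₄ → W} (hF : BoundedBelow N F) :
    IsLaurent₂ (diag F) := ⟨2 * N, fun m n h =>
  finsum_eq_zero_of_forall_eq_zero fun s => hF _ (by dsimp only; omega)⟩

theorem diag_sum {ι : Type*} (s : Finset ι) (c : ι → ℂ) {F : ι → Exp₄ → W}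
    (hF : ∀ i ∈ s, DiagFinite (F i)) :
    diag (∑ i ∈ s, c i • F i) = ∑ i ∈ s, c i • diag (F i) := by
  ext m n
  simp only [diag, Finset.sum_apply, Pi.smul_apply]
  rw [finsum_sum_comm]
  · exact Finset.sum_congr rfl fun i hi => (smul_finsum' _ (hF i hi m n)).symm
  · intro i hi
    exact (hF i hi m n).subset (Function.support_const_smul_subset (c i) _)

theorem expandFst_sum {ι : Type*} (s : Finset ι) (c : ι → ℂ) {A : ι → ℤ → ℤ → W}
    (hA : ∀ i ∈ s, IsLaurent₂ (A i)) :
    expandFst (∑ i ∈ s, c i • A i) = ∑ i ∈ s, c i • expandFst (A i) := by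
  ext p q
  simp only [expandFst, kernelSub, Finset.sum_apply, Pi.smul_apply, Finset.smul_sum]
  have hfin : ∀ i ∈ s, (Function.support fun m : ℤ => binomZ m p • A i m (p + q - m)).Finite :=
    fun i hi => (hA i hi).kernelFinite binomZ p q
  rw [finsum_sum_comm]
  · refine Finset.sum_congr rfl fun i hi => ?_
    rw [smul_finsum' _ (hfin i hi)]
    exact finsum_congr fun m => smul_comm _ _ _
  · intro i hi
    refine (hfin i hi).subset fun m hm h0 => hm ?_
    dsimp only at h0 ⊢
    rw [smul_comm, h0, smul_zero]

theorem expandFst_congr {A B : ℤ → ℤ → W} {p q : ℤ} (h : ∀ m, A m (p + q - m) = B m (p + q - m)) :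
    expandFst A p q = expandFst B p q :=
  finsum_congr fun m => by rw [h]

/-- Under `x = y + x₀` the factor `y - x` becomes `-x₀`; this is the origin of the argument `-x` in
`Y_R`. -/
theorem IsLaurent₂.expandFst_iterate_mulLin_neg {A : ℤ → ℤ → W} (hA : IsLaurent₂ A) (r : ℕ) :
    expandFst ((mulLin (-1) 1)^[r] A) = (-1 : ℤ) ^ r • shift r 0 (expandFst A) := by
  have hneg : ∀ B : ℤ → ℤ → W, mulLin (-1) 1 B = -mulLin 1 (-1) B := fun B => by
    ext m n
    simp [mulLin_neg_one_apply, mulLin_one_neg_apply]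
  induction r with
  | zero => simp [shift_zero]
  | succ r ih =>
    rw [Function.iterate_succ_apply', hneg, expandFst, kernelSub_neg, kernelSub_mulLin
      isPascal_binomZ ((hA.iterate_mulLin (-1) 1 r).kernelFinite _), ← expandFst, ih]
    ext p q
    simp only [shift, Pi.neg_apply, Pi.smul_apply, pow_succ, mul_neg, mul_one, neg_smul]
    rw [show p - 1 - r = p - ((r + 1 : ℕ) : ℤ) by push_cast; ring, sub_zero]

theorem iterate_mulLin_neg_even (A : ℤ → ℤ → W) (k : ℕ) (hk : Even k) :
    (mulLin (-1) 1)^[k] A = (mulLin 1 (-1))^[k] A := by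
  obtain ⟨n, rfl⟩ := hk
  have h2 : (mulLin (W := W) (-1) 1)^[2] = (mulLin 1 (-1))^[2] := by
    funext B m n
    simp only [Function.iterate_succ_apply, Function.iterate_zero, id, mulLin_neg_one_apply,
      mulLin_one_neg_apply]
    abel
  rw [← two_mul, Function.iterate_mul, Function.iterate_mul, h2]

/-- Substituting `x = z + s`, `y = t + s` and then `t = z` amounts to substituting `x = z + s₁`,
`y = t + s₂` and then `t = z`, `s₁ = s₂ = s`. -/
theorem BoundedBelow.expandFst_diag {N : ℤ} {F : Exp₄ → W} (hF : BoundedBelow N F) (p q : ℤ) :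
    expandFst (diag F) p q = ∑ c ∈ Finset.Icc 0 p, ∑ᶠ j : ℤ, expandFst (fun m₁ n₁ =>
      expandFst (fun m₂ n₂ => F (m₁, n₁, m₂, n₂)) (p - c) (q - j)) c j := by
  -- Monomials of total degree `p + q`, indexed by the joint degree in `x` and `y`, the degree in
  -- `x` and the degree in `z`. Both sides become sums of these coefficients, with weights that
  -- agree by Vandermonde's identity `binomZ_add`.
  set G : ℤ × ℤ × ℤ → W := fun s => F (s.2.1, s.2.2, s.1 - s.2.1, p + q - s.1 - s.2.2) with hG
  have hGfin : (Function.support G).Finite := by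
    refine ((Set.finite_Icc (2 * N) (p + q - 2 * N)).prod ((Set.finite_Icc N (p + q - 3 * N)).prod
      (Set.finite_Icc N (p + q - 3 * N)))).subset fun s hs => ?_
    by_contra h
    rw [Set.mem_prod, Set.mem_prod, Set.mem_Icc, Set.mem_Icc, Set.mem_Icc] at h
    exact hs (hF _ (by dsimp only; omega))
  have hsub : ∀ κ : ℤ × ℤ × ℤ → ℤ, (Function.support fun s => κ s • G s).Finite := fun κ =>
    hGfin.subset fun s hs h0 => hs (by dsimp only; rw [h0, smul_zero])
  have h1 : expandFst (diag F) p q = ∑ᶠ s, binomZ s.1 p • G s := by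
    rw [finsum_curry _ (hsub _)]
    refine finsum_congr fun m => ?_
    exact smul_finsum' _ (hF.diagFinite m (p + q - m))
  have h2 : ∀ c, (∑ᶠ j : ℤ, expandFst (fun m₁ n₁ =>
      expandFst (fun m₂ n₂ => F (m₁, n₁, m₂, n₂)) (p - c) (q - j)) c j) =
      ∑ᶠ s, (binomZ s.2.1 c * binomZ (s.1 - s.2.1) (p - c)) • G s := by
    intro c
    -- The source coordinates are `(j, m₁, m₂)`, matching the order of the iterated sums on the
    -- left.
    let e : ℤ × ℤ × ℤ ≃ ℤ × ℤ × ℤ :=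
      { toFun := fun s => (s.2.1 + s.2.2, s.2.1, c + s.1 - s.2.1)
        invFun := fun s => (s.2.2 + s.2.1 - c, s.2.1, s.1 - s.2.1)
        left_inv := fun s => by ext <;> dsimp only <;> ring
        right_inv := fun s => by ext <;> dsimp only <;> ring }
    rw [← finsum_comp_equiv e, finsum_curry₃ (fun s => (binomZ (e s).2.1 c *
      binomZ ((e s).1 - (e s).2.1) (p - c)) • G (e s)) ((hsub fun s => binomZ s.2.1 c *
        binomZ (s.1 - s.2.1) (p - c)).preimage e.injective.injOn)]
    refine finsum_congr fun j => finsum_congr fun m₁ => ?_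
    change binomZ m₁ c • (∑ᶠ m₂ : ℤ, binomZ m₂ (p - c) •
      F (m₁, c + j - m₁, m₂, p - c + (q - j) - m₂)) = _
    rw [smul_finsum']
    · refine finsum_congr fun m₂ => ?_
      simp only [e, hG, Equiv.coe_fn_mk, add_sub_cancel_left, smul_smul]
      congr 3
      simp only [Prod.ext_iff, true_and]
      ring
    · refine (Set.finite_Icc N (p - c + (q - j) - N)).subset fun m hm => ?_
      by_contra h
      rw [Set.mem_Icc] at h
      refine hm ?_
      dsimp only
      rw [hF _ (by dsimp only; omega), smul_zero]
  rw [h1, Finset.sum_congr rfl fun c _ => h2 c, ← finsum_sum_comm _ _ fun c _ => hsub _]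
  refine finsum_congr fun s => ?_
  rw [← Finset.sum_smul, ← binomZ_add, add_sub_cancel]

end FourVariables

/-! ### The candidate vertex operator map on `U ⊗ V`. -/

section JointField

variable {U V W : Type*} [AddCommGroup U] [Module ℂ U] [AddCommGroup V] [Module ℂ V]
  [AddCommGroup W] [Module ℂ W] {YU : U →ₗ[ℂ] W →ₗ[ℂ] W⸨X⸩} {YV : V →ₗ[ℂ] W →ₗ[ℂ] W⸨X⸩}

theorem prodSeries_apply (YU : U →ₗ[ℂ] W →ₗ[ℂ] W⸨X⸩) (YV : V →ₗ[ℂ] W →ₗ[ℂ] W⸨X⸩) (u : U) (v : V)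
    (w : W) (m n : ℤ) : prodSeries YU YV u v w m n = mode YU m u (mode YV n v w) := rfl

theorem IsLaurent₂.finite_support_antidiagonal {A : ℤ → ℤ → W} (hA : IsLaurent₂ A) (n : ℤ) :
    (Function.support fun m : ℤ => A m (n - m)).Finite := by
  obtain ⟨N, hN⟩ := hA
  refine (Set.finite_Icc N (n - N)).subset fun m hm => ?_
  by_contra h
  rw [Set.mem_Icc] at h
  exact hm (hN _ _ (by omega))

/-- `YU(u, x) YV(v, x) w`. -/
def jointField (hreg : ∀ (u : U) (v : V) (w : W), IsLaurent₂ (prodSeries YU YV u v w)) :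
    U ⊗[ℂ] V →ₗ[ℂ] W →ₗ[ℂ] W⸨X⸩ :=
  TensorProduct.lift (LinearMap.mk₂ ℂ
    (fun u v =>
      { toFun := fun w => HahnSeries.ofSuppBddBelow
          (fun n => ∑ᶠ m : ℤ, prodSeries YU YV u v w m (n - m)) (by
            obtain ⟨N, hN⟩ := hreg u v w
            refine ⟨2 * N, fun n hn => ?_⟩
            by_contra h
            exact hn (finsum_eq_zero_of_forall_eq_zero fun m => hN _ _ (by omega)))
        map_add' := fun w w' => by
          ext n
          simp only [HahnSeries.coeff_ofSuppBddBelow, HahnSeries.coeff_add]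
          rw [← finsum_add_distrib ((hreg u v w).finite_support_antidiagonal n)
            ((hreg u v w').finite_support_antidiagonal n)]
          simp [prodSeries_apply]
        map_smul' := fun c w => by
          ext n
          simp only [HahnSeries.coeff_ofSuppBddBelow, HahnSeries.coeff_smul, RingHom.id_apply]
          rw [smul_finsum' c ((hreg u v w).finite_support_antidiagonal n)]
          simp [prodSeries_apply] })
    (fun u u' v => by
      ext w n
      simp only [LinearMap.coe_mk, AddHom.coe_mk, LinearMap.add_apply,
        HahnSeries.coeff_ofSuppBddBelow, HahnSeries.coeff_add]
      rw [← finsum_add_distrib ((hreg u v w).finite_support_antidiagonal n)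
        ((hreg u' v w).finite_support_antidiagonal n)]
      simp [prodSeries_apply])
    (fun c u v => by
      ext w n
      simp only [LinearMap.coe_mk, AddHom.coe_mk, LinearMap.smul_apply,
        HahnSeries.coeff_ofSuppBddBelow, HahnSeries.coeff_smul]
      rw [smul_finsum' c ((hreg u v w).finite_support_antidiagonal n)]
      simp [prodSeries_apply])
    (fun u v v' => by
      ext w n
      simp only [LinearMap.coe_mk, AddHom.coe_mk, LinearMap.add_apply,
        HahnSeries.coeff_ofSuppBddBelow, HahnSeries.coeff_add]
      rw [← finsum_add_distrib ((hreg u v w).finite_support_antidiagonal n)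
        ((hreg u v' w).finite_support_antidiagonal n)]
      simp [prodSeries_apply])
    (fun c u v => by
      ext w n
      simp only [LinearMap.coe_mk, AddHom.coe_mk, LinearMap.smul_apply,
        HahnSeries.coeff_ofSuppBddBelow, HahnSeries.coeff_smul]
      rw [smul_finsum' c ((hreg u v w).finite_support_antidiagonal n)]
      simp [prodSeries_apply]))

variable (hreg : ∀ (u : U) (v : V) (w : W), IsLaurent₂ (prodSeries YU YV u v w))

theorem jointField_coeff (u : U) (v : V) (w : W) (n : ℤ) :
    (jointField hreg (u ⊗ₜ v) w).coeff n = ∑ᶠ m : ℤ, prodSeries YU YV u v w m (n - m) := rfl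

theorem mode_jointField (u : U) (v : V) (w : W) (n : ℤ) :
    mode (jointField hreg) n (u ⊗ₜ v) w = ∑ᶠ m : ℤ, mode YU m u (mode YV (n - m) v w) := rfl

theorem jointField_vac_right {v₀ : V} (hv₀ : ∀ w : W, YV v₀ w = HahnSeries.single 0 w) (u : U) :
    jointField hreg (u ⊗ₜ v₀) = YU u := by
  ext w n
  rw [jointField_coeff, finsum_eq_single _ n]
  · rw [prodSeries_apply, sub_self, mode_apply YV, hv₀, HahnSeries.coeff_single_same, mode_apply]
  · intro m hm
    rw [prodSeries_apply, mode_apply YV, hv₀, HahnSeries.coeff_single_of_ne (by omega), map_zero]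

theorem jointField_vac_left {u₀ : U} (hu₀ : ∀ w : W, YU u₀ w = HahnSeries.single 0 w) (v : V) :
    jointField hreg (u₀ ⊗ₜ v) = YV v := by
  ext w n
  rw [jointField_coeff, finsum_eq_single _ 0]
  · rw [prodSeries_apply, sub_zero, mode_apply YU, hu₀, HahnSeries.coeff_single_same, mode_apply]
  · intro m hm
    rw [prodSeries_apply, mode_apply YU, hu₀, HahnSeries.coeff_single_of_ne (by omega)]

/-- The coefficients of `YU(u, x) YV(v, y) YU(u', z) YV(v', t) w`. -/
def mixedProd (YU : U →ₗ[ℂ] W →ₗ[ℂ] W⸨X⸩) (YV : V →ₗ[ℂ] W →ₗ[ℂ] W⸨X⸩) (u u' : U) (v v' : V)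
    (w : W) : Exp₄ → W :=
  fun e => mode YU e.1 u (mode YV e.2.2.1 v (mode YU e.2.1 u' (mode YV e.2.2.2 v' w)))

/-- The coefficients of `YU(u, x) YU(u', z) YV(v, y) YV(v', t) w`. -/
def orderedProd (YU : U →ₗ[ℂ] W →ₗ[ℂ] W⸨X⸩) (YV : V →ₗ[ℂ] W →ₗ[ℂ] W⸨X⸩) (u u' : U) (v v' : V)
    (w : W) : Exp₄ → W :=
  fun e => mode YU e.1 u (mode YU e.2.1 u' (mode YV e.2.2.1 v (mode YV e.2.2.2 v' w)))

/-- The mixed product itself need not be bounded below. Regularity of the inner pair leaves finitely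
many exponents of `z`, and for each of them regularity of the outer pair leaves finitely many
exponents of `x`. -/
theorem diagFinite_mixedProd (hreg : ∀ (u : U) (v : V) (w : W), IsLaurent₂ (prodSeries YU YV u v w))
    (u u' : U) (v v' : V) (w : W) : DiagFinite (mixedProd YU YV u u' v v' w) := fun m n => by
  have h : (Function.support fun s : ℤ × ℤ =>
      mixedProd YU YV u u' v v' w (s.2, s.1, m - s.2, n - s.1)).Finite := by
    refine finite_support_of_fibers ((hreg u' v' w).finite_support_antidiagonal n)
      (fun a ha b => ?_) fun a _ => ?_
    · rw [Function.mem_support, not_not, prodSeries_apply] at ha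
      simp only [mixedProd]
      rw [ha, map_zero, map_zero]
    · exact (hreg u v (mode YU a u' (mode YV (n - a) v' w))).finite_support_antidiagonal m
  refine (h.image Prod.swap).subset fun s hs => ⟨s.swap, hs, by simp⟩

theorem fieldProd_jointField (u u' : U) (v v' : V) (w : W) :
    fieldProd (jointField hreg) (u ⊗ₜ v) (u' ⊗ₜ v') w =
      diag (mixedProd YU YV u u' v v' w) := by
  ext m n
  rw [diag, finsum_curry _ (diagFinite_mixedProd hreg u u' v v' w m n), fieldProd, mode_jointField]
  refine finsum_congr fun i => ?_
  rw [mode_jointField]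
  exact map_finsum (mode YU i u ∘ₗ mode YV (m - i) v)
    ((hreg u' v' w).finite_support_antidiagonal n)

end JointField

/-! ### The vertex operator of `U ⊗_R V`, and uniqueness of the module structure. -/

section TwistedProduct

variable {U V : Type*} [AddCommGroup U] [Module ℂ U] [AddCommGroup V] [Module ℂ V]

theorem twistedY_of_eq_sum (A : VertexData U) (B : VertexData V)
    {R : V ⊗[ℂ] U →ₗ[ℂ] (U ⊗[ℂ] V) ⊗[ℂ] ℂ⸨X⸩} {v : V} {u' : U} {ι : Type} [Fintype ι]
    {b : ι → U} {a : ι → V} {f : ι → ℂ⸨X⸩} (h : R (v ⊗ₜ u') = ∑ i, (b i ⊗ₜ a i) ⊗ₜ f i)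
    (u : U) (v' : V) :
    twistedY A B R (u ⊗ₜ v) (u' ⊗ₜ v') = ∑ i, laurentMul (LinearMap.lsmul ℂ (U ⊗[ℂ] V)).flip
      (laurentMul (TensorProduct.mk ℂ U V) (A.Y u (b i)) (B.Y (a i) v')) (negVar (f i)) := by
  have h1 : twistedY A B R (u ⊗ₜ v) (u' ⊗ₜ v') = twistedAux A B u v' (R (v ⊗ₜ u')) := rfl
  rw [h1, h, map_sum]
  rfl

theorem twistedY_coeff_of_eq_sum (A : VertexData U) (B : VertexData V)
    {R : V ⊗[ℂ] U →ₗ[ℂ] (U ⊗[ℂ] V) ⊗[ℂ] ℂ⸨X⸩} {v : V} {u' : U} {ι : Type} [Fintype ι]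
    {b : ι → U} {a : ι → V} {f : ι → ℂ⸨X⸩} (h : R (v ⊗ₜ u') = ∑ i, (b i ⊗ₜ a i) ⊗ₜ f i)
    (u : U) (v' : V) (p : ℤ) :
    (twistedY A B R (u ⊗ₜ v) (u' ⊗ₜ v')).coeff p = ∑ i, ∑ᶠ n : ℤ, (negVar (f i)).coeff (p - n) •
      (laurentMul (TensorProduct.mk ℂ U V) (A.Y u (b i)) (B.Y (a i) v')).coeff n := by
  rw [twistedY_of_eq_sum A B h, ← coeffL_apply, map_sum]
  rfl

theorem twistedY_tmul_vac (A : VertexData U) (B : VertexData V)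
    (hB : ∀ v : V, B.Y B.vac v = HahnSeries.single 0 v)
    {R : V ⊗[ℂ] U →ₗ[ℂ] (U ⊗[ℂ] V) ⊗[ℂ] ℂ⸨X⸩}
    (hR : ∀ u : U, R (B.vac ⊗ₜ u) = (u ⊗ₜ B.vac) ⊗ₜ 1) (u u' : U) (v' : V) (p : ℤ) :
    (twistedY A B R (u ⊗ₜ B.vac) (u' ⊗ₜ v')).coeff p = (A.Y u u').coeff p ⊗ₜ v' := by
  have h : R (B.vac ⊗ₜ u') = ∑ _i : Unit, (u' ⊗ₜ B.vac) ⊗ₜ 1 := by simp [hR]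
  rw [twistedY_coeff_of_eq_sum A B h, Fintype.sum_unique, finsum_eq_single _ p]
  · rw [sub_self, negVar_coeff, HahnSeries.coeff_one, if_pos rfl, Int.negOnePow_zero, one_smul,
      one_smul, laurentMul_coeff, finsum_eq_single _ p]
    · rw [sub_self, hB, HahnSeries.coeff_single_same]
      rfl
    · intro i hi
      rw [hB, HahnSeries.coeff_single_of_ne (by omega), map_zero]
  · intro n hn
    rw [negVar_coeff, HahnSeries.coeff_one, if_neg (by omega), smul_zero, zero_smul]

variable {W : Type*} [AddCommGroup W] [Module ℂ W] {YU : U →ₗ[ℂ] W →ₗ[ℂ] W⸨X⸩}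
  {YV : V →ₗ[ℂ] W →ₗ[ℂ] W⸨X⸩}

/-- A module structure over `U ⊗_R V` is determined by its restrictions to `U` and `V`. -/
theorem eq_jointField_of_isModule
    (hreg : ∀ (u : U) (v : V) (w : W), IsLaurent₂ (prodSeries YU YV u v w))
    {A : VertexData U} (hA : A.IsNonlocalVertexAlgebra)
    {B : VertexData V} (hB : B.IsNonlocalVertexAlgebra)
    {R : V ⊗[ℂ] U →ₗ[ℂ] (U ⊗[ℂ] V) ⊗[ℂ] ℂ⸨X⸩} (hR : IsTwistingOperator A B R)
    {Y : U ⊗[ℂ] V →ₗ[ℂ] W →ₗ[ℂ] W⸨X⸩} (hY : (twistedTensor A B R).IsModule Y)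
    (hYU : ∀ u : U, Y (u ⊗ₜ B.vac) = YU u) (hYV : ∀ v : V, Y (A.vac ⊗ₜ v) = YV v) :
    Y = jointField hreg := by
  refine TensorProduct.ext' fun u v => ?_
  ext w q
  have hcoeff := twistedY_tmul_vac A B hB.vac_left hR.vac_left u A.vac v
  -- There is no pole, because `Y(u, x)𝟏` is regular, so no factor `x - y` is needed. The
  -- coefficient of `x₀ ^ 0` then recovers `Y (u ⊗ₜ v)`, since the constant term of `Y(u, x)𝟏` is
  -- `u`.
  have hop := (hY.weakAssoc (u ⊗ₜ B.vac) (A.vac ⊗ₜ v) w).operatorProduct (k := 0) fun n hn => by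
    change (twistedY A B R _ _).coeff n = 0
    rw [hcoeff, hA.vac_right_regular u n (by simpa using hn), TensorProduct.zero_tmul]
  have h1 := congrFun (congrFun hop.2 0) q
  have h2 : prodField (twistedTensor A B R).Y Y (u ⊗ₜ B.vac) (A.vac ⊗ₜ v) w 0 q =
      (Y (u ⊗ₜ v) w).coeff q := by
    change (Y ((twistedY A B R (u ⊗ₜ B.vac) (A.vac ⊗ₜ v)).coeff 0) w).coeff q = _
    rw [hcoeff, hA.vac_right_limit]
  rw [Nat.cast_zero, shift_zero, h2] at h1
  rw [h1, jointField_coeff, expandFst, kernelSub]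
  refine finsum_congr fun m => ?_
  rw [binomZ_zero_right, one_smul, zero_add, Function.iterate_zero, id, fieldProd,
    prodSeries_apply, mode_apply Y, mode_apply Y, hYU, hYV]
  rfl

end TwistedProduct

/-! ### Additivity of weak associativity, reducing it to pure tensors. -/

section WeakAssocLinear

variable {V W : Type*} [AddCommGroup V] [Module ℂ V] [AddCommGroup W] [Module ℂ W]
  {Y : V →ₗ[ℂ] V →ₗ[ℂ] V⸨X⸩} {YW : V →ₗ[ℂ] W →ₗ[ℂ] W⸨X⸩}

theorem iterate_mulLin_add {W : Type*} [AddCommGroup W] (ε δ : ℤˣ) (A A' : ℤ → ℤ → W) (k : ℕ) :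
    (mulLin ε δ)^[k] (A + A') = (mulLin ε δ)^[k] A + (mulLin ε δ)^[k] A' := by
  induction k with
  | zero => rfl
  | succ k ih =>
    rw [Function.iterate_succ_apply', ih, Function.iterate_succ_apply',
      Function.iterate_succ_apply']
    ext m n
    simp only [mulLin, Pi.add_apply, smul_add]
    abel

theorem iterate_mulLin_eq_mono {W : Type*} [AddCommGroup W] {ε δ : ℤˣ} {A A' : ℤ → ℤ → W}
    {k k' : ℕ} (hk : k ≤ k') (h : (mulLin ε δ)^[k] A = (mulLin ε δ)^[k] A') :
    (mulLin ε δ)^[k'] A = (mulLin ε δ)^[k'] A' := by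
  obtain ⟨d, rfl⟩ := Nat.exists_eq_add_of_le' hk
  rw [Function.iterate_add_apply, h, Function.iterate_add_apply]

theorem exists_iterate_mulLin_add {E₁ E₂ D₁ D₂ : ℤ → ℤ → W}
    (h₁ : ∃ l : ℕ, (mulLin 1 1)^[l] E₁ = (mulLin 1 1)^[l] D₁)
    (h₂ : ∃ l : ℕ, (mulLin 1 1)^[l] E₂ = (mulLin 1 1)^[l] D₂) :
    ∃ l : ℕ, (mulLin 1 1)^[l] (E₁ + E₂) = (mulLin 1 1)^[l] (D₁ + D₂) := by
  obtain ⟨l₁, h₁⟩ := h₁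
  obtain ⟨l₂, h₂⟩ := h₂
  refine ⟨max l₁ l₂, ?_⟩
  rw [iterate_mulLin_add, iterate_mulLin_add, iterate_mulLin_eq_mono (le_max_left _ _) h₁,
    iterate_mulLin_eq_mono (le_max_right _ _) h₂]

theorem expandSnd_fieldProd_add {u₁ v₁ u₂ v₂ u₃ v₃ : V} {w : W}
    (h : fieldProd YW u₃ v₃ w = fieldProd YW u₁ v₁ w + fieldProd YW u₂ v₂ w) :
    expandSnd (fieldProd YW u₃ v₃ w) =
      expandSnd (fieldProd YW u₁ v₁ w) + expandSnd (fieldProd YW u₂ v₂ w) := by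
  obtain ⟨N₁, h₁⟩ := fieldProd_bound_snd YW u₁ v₁ w
  obtain ⟨N₂, h₂⟩ := fieldProd_bound_snd YW u₂ v₂ w
  rw [h]
  exact kernelSub_add (kernelFinite_binomZ_sub h₁) (kernelFinite_binomZ_sub h₂)

theorem WeakAssoc.add_left {u₁ u₂ v : V} {w : W} (h₁ : WeakAssoc Y YW u₁ v w)
    (h₂ : WeakAssoc Y YW u₂ v w) : WeakAssoc Y YW (u₁ + u₂) v w := by
  rw [weakAssoc_iff] at *
  rw [expandSnd_fieldProd_add (u₁ := u₁) (v₁ := v) (u₂ := u₂) (v₂ := v)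
      (by ext m n; simp [fieldProd]),
    show prodField Y YW (u₁ + u₂) v w = prodField Y YW u₁ v w + prodField Y YW u₂ v w by
      ext p q; simp [prodField]]
  exact exists_iterate_mulLin_add h₁ h₂

theorem WeakAssoc.add_right {u v₁ v₂ : V} {w : W} (h₁ : WeakAssoc Y YW u v₁ w)
    (h₂ : WeakAssoc Y YW u v₂ w) : WeakAssoc Y YW u (v₁ + v₂) w := by
  rw [weakAssoc_iff] at *
  rw [expandSnd_fieldProd_add (u₁ := u) (v₁ := v₁) (u₂ := u) (v₂ := v₂)
      (by ext m n; simp [fieldProd]),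
    show prodField Y YW u (v₁ + v₂) w = prodField Y YW u v₁ w + prodField Y YW u v₂ w by
      ext p q; simp [prodField]]
  exact exists_iterate_mulLin_add h₁ h₂

theorem weakAssoc_zero_left (v : V) (w : W) : WeakAssoc Y YW 0 v w := by
  rw [weakAssoc_iff]
  refine ⟨0, ?_⟩
  ext p q
  simp [expandSnd, kernelSub, fieldProd, prodField]

theorem weakAssoc_zero_right (u : V) (w : W) : WeakAssoc Y YW u 0 w := by
  rw [weakAssoc_iff]
  refine ⟨0, ?_⟩
  ext p q
  simp [expandSnd, kernelSub, fieldProd, prodField]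

end WeakAssocLinear

/-! ### Ordered products `YU YU YV YV`: boundedness and substitution. -/

section OrderedProduct

variable {W : Type*} [AddCommGroup W] [Module ℂ W]

theorem iterate_mulDiff_fst (F : Exp₄ → W) (k : ℕ) (i j : ℤ) (s : ℤ × ℤ) :
    (mulDiff (1, 0, 0, 0) (0, 1, 0, 0))^[k] F (i, j, s) =
      (mulLin 1 (-1))^[k] (fun m n => F (m, n, s)) i j := by
  induction k generalizing i j with
  | zero => rfl
  | succ k ih =>
    rw [Function.iterate_succ_apply', Function.iterate_succ_apply', mulLin_one_neg_apply, ← ih,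
      ← ih, mulDiff]
    simp [Prod.mk_sub_mk, ← Prod.zero_eq_mk]

theorem iterate_mulDiff_snd (F : Exp₄ → W) (r : ℕ) (i j k l : ℤ) :
    (mulDiff (0, 0, 1, 0) (0, 0, 0, 1))^[r] F (i, j, k, l) =
      (mulLin 1 (-1))^[r] (fun m n => F (i, j, m, n)) k l := by
  induction r generalizing k l with
  | zero => rfl
  | succ r ih =>
    rw [Function.iterate_succ_apply', Function.iterate_succ_apply', mulLin_one_neg_apply, ← ih,
      ← ih, mulDiff]
    simp [Prod.mk_sub_mk]

theorem iterate_mulDiff_mid (F : Exp₄ → W) (r : ℕ) (i j k l : ℤ) :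
    (mulDiff (0, 1, 0, 0) (0, 0, 1, 0))^[r] F (i, j, k, l) =
      (mulLin (-1) 1)^[r] (fun y z => F (i, z, y, l)) k j := by
  induction r generalizing j k with
  | zero => rfl
  | succ r ih =>
    rw [Function.iterate_succ_apply', Function.iterate_succ_apply', mulLin_neg_one_apply, ← ih,
      ← ih, mulDiff]
    simp [Prod.mk_sub_mk]

variable {U V : Type*} [AddCommGroup U] [Module ℂ U] [AddCommGroup V] [Module ℂ V]
  {YU : U →ₗ[ℂ] W →ₗ[ℂ] W⸨X⸩} {YV : V →ₗ[ℂ] W →ₗ[ℂ] W⸨X⸩}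

/-- `(x - z) ^ a * (y - t) ^ b * YU(u, x) YU(u', z) YV(v, y) YV(v', t) w`. -/
def regularProd (YU : U →ₗ[ℂ] W →ₗ[ℂ] W⸨X⸩) (YV : V →ₗ[ℂ] W →ₗ[ℂ] W⸨X⸩) (a b : ℕ) (u u' : U)
    (v v' : V) (w : W) : Exp₄ → W :=
  (mulDiff (1, 0, 0, 0) (0, 1, 0, 0))^[a] ((mulDiff (0, 0, 1, 0) (0, 0, 0, 1))^[b]
    (orderedProd YU YV u u' v v' w))

/-- The coefficients of `(x - y) ^ a * YU(u, x) YU(u', y)`. -/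
def fieldProdEnd (YU : U →ₗ[ℂ] W →ₗ[ℂ] W⸨X⸩) (a : ℕ) (u u' : U) : ℤ → ℤ → (W →ₗ[ℂ] W) :=
  (mulLin 1 (-1))^[a] (fun m n => mode YU m u ∘ₗ mode YU n u')

theorem fieldProdEnd_apply (a : ℕ) (u u' : U) (m n : ℤ) (w : W) :
    fieldProdEnd YU a u u' m n w = (mulLin 1 (-1))^[a] (fieldProd YU u u' w) m n :=
  (congrFun (congrFun (iterate_mulLin_map (LinearMap.applyₗ (R := ℂ) w) 1 (-1)
    (fun m n => mode YU m u ∘ₗ mode YU n u') a) m) n).symm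

theorem regularProd_apply (a b : ℕ) (u u' : U) (v v' : V) (w : W) (i j k l : ℤ) :
    regularProd YU YV a b u u' v v' w (i, j, k, l) =
      fieldProdEnd YU a u u' i j ((mulLin 1 (-1))^[b] (fieldProd YV v v' w) k l) := by
  rw [regularProd, iterate_mulDiff_fst, fieldProdEnd_apply]
  refine congrFun (congrFun (congrArg _ ?_) i) j
  funext m n
  rw [iterate_mulDiff_snd]
  exact congrFun (congrFun (iterate_mulLin_map (mode YU m u ∘ₗ mode YU n u') 1 (-1)
    (fieldProd YV v v' w) b) k) l

/-- Both the pairs of fields from `U` and from `V` being regular, so is the whole product. -/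
theorem boundedBelow_regularProd {a b : ℕ} {u u' : U} {v v' : V} {w : W} {N : ℤ}
    (hU : ∀ m n, (m < N ∨ n < N) → ∀ k l, (mulLin 1 (-1))^[a]
      (fieldProd YU u u' (fieldProd YV v v' w k l)) m n = 0)
    (hV : ∀ m n, (m < N ∨ n < N) → (mulLin 1 (-1))^[b] (fieldProd YV v v' w) m n = 0) :
    BoundedBelow N (regularProd YU YV a b u u' v v' w) := by
  rintro ⟨i, j, k, l⟩ h
  rw [regularProd_apply]
  by_cases h' : k < N ∨ l < N
  · rw [hV k l h', map_zero]
  · have hij : i < N ∨ j < N := by dsimp only at h; omega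
    -- In this case the `V`-exponents are unrestricted: the `U`-part already kills each coefficient
    -- of the `V`-product, and `(y - t) ^ b` only takes combinations of these.
    have h0 : (fun k l => fieldProdEnd YU a u u' i j (fieldProd YV v v' w k l)) =
        fun _ _ => 0 := by
      ext k l
      rw [fieldProdEnd_apply, hU i j hij]
    have h1 := congrFun (congrFun (iterate_mulLin_map (fieldProdEnd YU a u u' i j) 1 (-1)
      (fieldProd YV v v' w) b) k) l
    rw [h0] at h1
    rw [← h1]
    exact iterate_mulLin_bound_fst 1 (-1) (N := k + 1) (fun _ _ _ => rfl) b k l (by omega)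

theorem expandFst_map {W' F : Type*} [AddCommGroup W'] [FunLike F W W'] [AddMonoidHomClass F W W']
    (f : F) {A : ℤ → ℤ → W} (hA : IsLaurent₂ A) (p q : ℤ) :
    expandFst (fun m n => f (A m n)) p q = f (expandFst A p q) := by
  rw [expandFst, expandFst, kernelSub, kernelSub, map_finsum f (hA.kernelFinite binomZ p q)]
  exact finsum_congr fun m => (map_zsmul f _ _).symm

/-- By `BoundedBelow.expandFst_diag` the two pairs may be substituted separately. The `V`-pair gives
`s^b YV(Y(v, s)v', t)w`, then the `U`-pair gives `s^a YU(Y(u, s)u', z)` acting on its coefficients,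
and setting `t = z` assembles the joint field of `Y(u, s)u' ⊗ Y(v, s)v'`. The pole bounds confine
the resulting convolution to `0 ≤ c ≤ p`. -/
theorem expandFst_diag_regularProd (A : VertexData U) (B : VertexData V)
    {Y : U ⊗[ℂ] V →ₗ[ℂ] W →ₗ[ℂ] W⸨X⸩}
    (hY : ∀ u v w n, mode Y n (u ⊗ₜ v) w = ∑ᶠ m : ℤ, mode YU m u (mode YV (n - m) v w))
    {a b : ℕ} {u u' : U} {v v' : V} {w : W} {N : ℤ}
    (hF : BoundedBelow N (regularProd YU YV a b u u' v v' w))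
    (hUpole : ∀ n : ℤ, n < -(a : ℤ) → (A.Y u u').coeff n = 0)
    (hVpole : ∀ n : ℤ, n < -(b : ℤ) → (B.Y v v').coeff n = 0)
    (hU : ∀ w, OperatorProduct a (fieldProd YU u u' w) (prodField A.Y YU u u' w))
    (hV : OperatorProduct b (fieldProd YV v v' w) (prodField B.Y YV v v' w)) (p q : ℤ) :
    expandFst (diag (regularProd YU YV a b u u' v v' w)) p q =
      mode Y q ((laurentMul (TensorProduct.mk ℂ U V) (A.Y u u') (B.Y v v')).coeff (p - (a + b))) w := by
  have hterm : ∀ c j : ℤ, expandFst (fun m₁ n₁ => expandFst (fun m₂ n₂ =>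
      regularProd YU YV a b u u' v v' w (m₁, n₁, m₂, n₂)) (p - c) (q - j)) c j =
      mode YU j ((A.Y u u').coeff (c - a)) (mode YV (q - j) ((B.Y v v').coeff (p - c - b)) w) := by
    intro c j
    have h1 : ∀ m₁ n₁, expandFst (fun m₂ n₂ =>
        regularProd YU YV a b u u' v v' w (m₁, n₁, m₂, n₂)) (p - c) (q - j) =
        (mulLin 1 (-1))^[a] (fieldProd YU u u'
          (mode YV (q - j) ((B.Y v v').coeff (p - c - b)) w)) m₁ n₁ := by
      intro m₁ n₁
      simp only [regularProd_apply]
      rw [expandFst_map _ hV.1, ← hV.2, fieldProdEnd_apply]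
      simp only [shift, prodField, sub_zero, mode_apply B.Y]
    simp only [h1]
    exact (congrFun (congrFun (hU (mode YV (q - j) ((B.Y v v').coeff (p - c - b)) w)).2 c) j).symm.trans
      (by simp only [shift, prodField, sub_zero, mode_apply A.Y])
  rw [hF.expandFst_diag]
  simp only [hterm]
  rw [laurentMul_coeff]
  have h2 := map_finsum ((mode Y q).flip w)
    (finite_support_conv (TensorProduct.mk ℂ U V) (A.Y u u') (B.Y v v') (p - (a + b)))
  simp only [LinearMap.flip_apply] at h2
  rw [h2, ← finsum_comp_equiv (Equiv.subRight (a : ℤ))]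
  rw [finsum_eq_sum_of_support_subset (s := Finset.Icc 0 p)]
  · refine Finset.sum_congr rfl fun c _ => ?_
    simp only [Equiv.subRight_apply, TensorProduct.mk_apply, hY]
    rw [show p - (a + b : ℤ) - (c - a) = p - c - b by ring]
  · intro c hc
    by_contra hc'
    rw [Finset.coe_Icc, Set.mem_Icc] at hc'
    refine hc ?_
    simp only [Equiv.subRight_apply]
    rcases lt_or_ge c 0 with hlt | hge
    · rw [hUpole _ (by omega)]
      simp
    · rw [hVpole _ (by omega)]
      simp

end OrderedProduct

/-! ### Weak associativity of the joint field. -/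

section Main

variable {U V W : Type*} [AddCommGroup U] [Module ℂ U] [AddCommGroup V] [Module ℂ V]
  [AddCommGroup W] [Module ℂ W] {YU : U →ₗ[ℂ] W →ₗ[ℂ] W⸨X⸩} {YV : V →ₗ[ℂ] W →ₗ[ℂ] W⸨X⸩}

/-- After multiplication by `(z - y) ^ k`, the fields `YV(v, y)` and `YU(u', z)` can be exchanged. -/
theorem iterate_mulDiff_mixedProd
    (hreg : ∀ (u : U) (v : V) (w : W), IsLaurent₂ (prodSeries YU YV u v w))
    {R : V ⊗[ℂ] U →ₗ[ℂ] (U ⊗[ℂ] V) ⊗[ℂ] ℂ⸨X⸩} {k : ℕ} {u' : U} {v : V}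
    (hloc : ∀ w : W, (mulLin (-1) 1)^[k] (prodSeries YV YU v u' w) =
        (mulLin (-1) 1)^[k] (twistedSeries YV YU R 1 (-1) v u' w))
    {ι : Type} [Fintype ι] {b : ι → U} {a : ι → V} {f : ι → ℂ⸨X⸩}
    (hR : R (v ⊗ₜ u') = ∑ i, (b i ⊗ₜ a i) ⊗ₜ f i)
    (hk : ∀ i, ∀ n : ℤ, n < -(k : ℤ) → (f i).coeff n = 0) (u : U) (v' : V) (w : W) (e : Exp₄) :
    (∀ i, (Function.support fun r : ℕ => (f i).coeff (r - k) •
      (mulDiff (0, 1, 0, 0) (0, 0, 1, 0))^[r] (orderedProd YU YV u (b i) (a i) v' w) e).Finite) ∧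
    (mulDiff (0, 1, 0, 0) (0, 0, 1, 0))^[k] (mixedProd YU YV u u' v v' w) e =
      ∑ i, ∑ᶠ r : ℕ, (f i).coeff (r - k) •
        (mulDiff (0, 1, 0, 0) (0, 0, 1, 0))^[r] (orderedProd YU YV u (b i) (a i) v' w) e := by
  obtain ⟨i₀, j₀, k₀, l₀⟩ := e
  have hC : ∀ i, IsLaurent₂ fun p q => mode YU q (b i) (mode YV p (a i) (mode YV l₀ v' w)) := by
    intro i
    obtain ⟨N, hN⟩ := hreg (b i) (a i) (mode YV l₀ v' w)
    exact ⟨N, fun p q h => hN q p h.symm⟩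
  have hmain := iterate_mulLin_twistedSeries YV YU hR hk hC k₀ j₀
  have hterm : ∀ i (r : ℕ), (f i).coeff (r - k) •
      (mulDiff (0, 1, 0, 0) (0, 0, 1, 0))^[r] (orderedProd YU YV u (b i) (a i) v' w)
        (i₀, j₀, k₀, l₀) = mode YU i₀ u ((f i).coeff (r - k) • (mulLin (-1) 1)^[r]
        (fun p q => mode YU q (b i) (mode YV p (a i) (mode YV l₀ v' w))) k₀ j₀) := by
    intro i r
    rw [map_smul, iterate_mulDiff_mid]
    congr 1
    exact congrFun (congrFun (iterate_mulLin_map (mode YU i₀ u) (-1) 1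
      (fun p q => mode YU q (b i) (mode YV p (a i) (mode YV l₀ v' w))) r) k₀) j₀
  simp only [hterm]
  refine ⟨fun i => finite_support_map (fun _ => mode YU i₀ u) (hmain.1 i), ?_⟩
  have h1 : (mulDiff (0, 1, 0, 0) (0, 0, 1, 0))^[k] (mixedProd YU YV u u' v v' w)
      (i₀, j₀, k₀, l₀) = mode YU i₀ u ((mulLin (-1) 1)^[k]
        (prodSeries YV YU v u' (mode YV l₀ v' w)) k₀ j₀) := by
    rw [iterate_mulDiff_mid]
    exact congrFun (congrFun (iterate_mulLin_map (mode YU i₀ u) (-1) 1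
      (prodSeries YV YU v u' (mode YV l₀ v' w)) k) k₀) j₀
  -- The locality exponent `k` must be independent of the vector: it is applied to every coefficient
  -- of `YV(v', t)w`.
  rw [h1, hloc, hmain.2, map_sum]
  exact Finset.sum_congr rfl fun i _ => map_finsum (mode YU i₀ u) (hmain.1 i)

/-- A single choice of exponents and bound serves all terms of `R(v ⊗ u')`, so that their locally
finite combination stays bounded. -/
theorem exists_bound_regularProd {A : VertexData U} {B : VertexData V} (hYU : A.IsModule YU)
    (hYV : B.IsModule YV) (hex : Exchange YU YV) {ι : Type} [Fintype ι] (u : U) (v' : V)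
    (b : ι → U) (a : ι → V) (w : W) :
    ∃ (α β : ℕ) (N : ℤ), ∀ i,
      (∀ n : ℤ, n < -(α : ℤ) → (A.Y u (b i)).coeff n = 0) ∧
      (∀ n : ℤ, n < -(β : ℤ) → (B.Y (a i) v').coeff n = 0) ∧
      BoundedBelow N (regularProd YU YV α β u (b i) (a i) v' w) := by
  choose pU hpU using fun i => exists_pole_bound A.Y u (b i)
  choose pV hpV using fun i => exists_pole_bound B.Y (a i) v'
  -- Two applications of `image_mode` bring the uniform bound from `w` to all coefficients of `YV(a
  -- i, y) YV(v', t) w`.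
  choose q hq using fun i => ((uniformlyBounded_singleton hYU w).image_mode hex v').image_mode hex
    (a i) u (b i)
  -- The sum dominates both the pole orders, needed for the operator product, and the exponents of
  -- uniform boundedness.
  set α := Finset.univ.sup pU + Finset.univ.sup q
  set β := Finset.univ.sup pV
  have hα : ∀ i, pU i ≤ α := fun i => (Finset.le_sup (Finset.mem_univ i)).trans (by omega)
  have hα' : ∀ i, q i ≤ α := fun i =>
    (Finset.le_sup (f := q) (Finset.mem_univ i)).trans (by omega)
  have hβ : ∀ i, pV i ≤ β := fun i => Finset.le_sup (Finset.mem_univ i)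
  choose N₁ hN₁ using fun i => hq i α (hα' i)
  choose N₂ hN₂ using fun i =>
    (((hYV.weakAssoc (a i) v' w).operatorProduct (hpV i)).mono (hβ i)).1
  obtain ⟨N, hN⟩ : ∃ N : ℤ, ∀ i, N ≤ min (N₁ i) (N₂ i) :=
    (Set.finite_range fun i => min (N₁ i) (N₂ i)).bddBelow.imp fun _ h i => h ⟨i, rfl⟩
  refine ⟨α, β, N, fun i => ⟨fun n hn => hpU i n (by have := hα i; omega),
    fun n hn => hpV i n (by have := hβ i; omega), boundedBelow_regularProd ?_ ?_⟩⟩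
  · intro m n hmn k l
    exact hN₁ i _ ⟨mode YV l v' w, ⟨w, rfl, l, rfl⟩, k, rfl⟩ m n (by have := hN i; omega)
  · intro m n hmn
    exact hN₂ i m n (by have := hN i; omega)

theorem operatorProduct_jointField {A : VertexData U} {B : VertexData V} (hYU : A.IsModule YU)
    (hYV : B.IsModule YV)
    (hreg : ∀ (u : U) (v : V) (w : W), IsLaurent₂ (prodSeries YU YV u v w))
    (hex : Exchange YU YV) {R : V ⊗[ℂ] U →ₗ[ℂ] (U ⊗[ℂ] V) ⊗[ℂ] ℂ⸨X⸩}
    (hloc : ∀ (u : U) (v : V), ∃ k : ℕ, ∀ w : W,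
      (mulLin (-1) 1)^[k] (prodSeries YV YU v u w) =
        (mulLin (-1) 1)^[k] (twistedSeries YV YU R 1 (-1) v u w))
    (u u' : U) (v v' : V) (w : W) :
    ∃ k : ℕ, OperatorProduct k (fieldProd (jointField hreg) (u ⊗ₜ v) (u' ⊗ₜ v') w)
      (prodField (twistedY A B R) (jointField hreg) (u ⊗ₜ v) (u' ⊗ₜ v') w) := by
  obtain ⟨ι, _, b, a, f, hR⟩ := exists_eq_sum_tmul_tmul (R (v ⊗ₜ u'))
  obtain ⟨α, β, N, hreglr⟩ := exists_bound_regularProd hYU hYV hex u v' b a w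
  obtain ⟨k, hkeven, hk, hlock⟩ : ∃ k : ℕ, Even k ∧
      (∀ i, ∀ n : ℤ, n < -(k : ℤ) → (f i).coeff n = 0) ∧ ∀ w : W,
      (mulLin (-1) 1)^[k] (prodSeries YV YU v u' w) =
        (mulLin (-1) 1)^[k] (twistedSeries YV YU R 1 (-1) v u' w) := by
    obtain ⟨k₀, hk₀⟩ := hloc u' v
    choose n₀ hn₀ using fun i => exists_coeff_eq_zero (f i)
    obtain ⟨n₁, hn₁⟩ : ∃ n₁ : ℤ, ∀ i, n₁ ≤ n₀ i :=
      (Set.finite_range n₀).bddBelow.imp fun _ h i => h ⟨i, rfl⟩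
    -- Large enough for locality and for the poles of all `f i`; evenness gives `(z - x) ^ k = (x -
    -- z) ^ k` and `(-1) ^ (r - k) = (-1) ^ r`.
    refine ⟨2 * (k₀ + (-n₁).toNat), even_two_mul _, fun i n hn => hn₀ i n ?_, fun w =>
      iterate_mulLin_eq_mono (by omega) (hk₀ w)⟩
    have := hn₁ i
    omega
  set gx : Exp₄ := (1, 0, 0, 0)
  set gz : Exp₄ := (0, 1, 0, 0)
  set gy : Exp₄ := (0, 0, 1, 0)
  set gt : Exp₄ := (0, 0, 0, 1)
  set P := mixedProd YU YV u u' v v' w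
  set M : ι → Exp₄ → W := fun i => regularProd YU YV α β u (b i) (a i) v' w
  set F : Exp₄ → W := (mulDiff gx gz)^[α] ((mulDiff gy gt)^[β] ((mulDiff gz gy)^[k] P))
  have hM : ∀ i, BoundedBelow N (M i) := fun i => (hreglr i).2.2
  have hMr : ∀ i (r : ℕ), BoundedBelow N ((mulDiff gz gy)^[r] (M i)) := fun i r =>
    (hM i).iterate_mulDiff (by simp [gz, Prod.le_def]) (by simp [gy, Prod.le_def]) r
  have hFsum : ∀ e, F e = ∑ i, ∑ᶠ r : ℕ, (f i).coeff (r - k) • (mulDiff gz gy)^[r] (M i) e := by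
    have h1 := iterate_mulDiff_mixedProd hreg hlock hR hk u v' w
    have h2 := iterate_mulDiff_finsum gy gt (B := fun i (r : ℕ) e => (f i).coeff (r - k) •
      (mulDiff gz gy)^[r] (orderedProd YU YV u (b i) (a i) v' w) e)
      (fun i e => (h1 e).1 i) (fun e => (h1 e).2) β
    have h3 := iterate_mulDiff_finsum gx gz h2.1 h2.2 α
    intro e
    refine (h3.2 e).trans ?_
    refine Finset.sum_congr rfl fun i _ => finsum_congr fun r => ?_
    have hs : ∀ (g h : Exp₄) (G : Exp₄ → W) (n : ℕ),
        (mulDiff g h)^[n] (fun e => (f i).coeff (r - k) • G e) =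
          fun e => (f i).coeff (r - k) • (mulDiff g h)^[n] G e := fun g h G n =>
      iterate_mulDiff_map (LinearMap.lsmul ℂ W ((f i).coeff (r - k))) g h G n
    -- The factors in `x - z` and `y - t` are moved inside the powers of `z - y`, where they
    -- regularize the ordered products.
    rw [hs, hs, ((mulDiff_commute gy gt gz gy).iterate_iterate β r).eq,
      ((mulDiff_commute gx gz gz gy).iterate_iterate α r).eq]
    rfl
  have hFN : BoundedBelow N F := fun e he => by
    rw [hFsum]
    refine Finset.sum_eq_zero fun i _ => finsum_eq_zero_of_forall_eq_zero fun r => ?_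
    rw [hMr i r e he, smul_zero]
  have hPfin : DiagFinite P := diagFinite_mixedProd hreg u u' v v' w
  have hdiag : diag F = (mulLin 1 (-1))^[α + β + k]
      (fieldProd (jointField hreg) (u ⊗ₜ v) (u' ⊗ₜ v') w) := by
    rw [fieldProd_jointField, Function.iterate_add_apply, Function.iterate_add_apply,
      ← iterate_mulLin_neg_even _ k hkeven]
    rw [diag_iterate_mulDiff ((hPfin.iterate_mulDiff _ _ _).iterate_mulDiff _ _ _) rfl rfl rfl rfl,
      diag_iterate_mulDiff (hPfin.iterate_mulDiff _ _ _) rfl rfl rfl rfl,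
      diag_iterate_mulDiff' hPfin rfl rfl rfl rfl]
  refine ⟨α + β + k, ?_⟩
  rw [OperatorProduct, ← hdiag]
  refine ⟨hFN.isLaurent₂_diag, ?_⟩
  ext p q
  have hD : ∀ i p q, expandFst (diag (M i)) p q = mode (jointField hreg) q
      ((laurentMul (TensorProduct.mk ℂ U V) (A.Y u (b i)) (B.Y (a i) v')).coeff (p - (α + β))) w :=
    fun i p q => expandFst_diag_regularProd A B (mode_jointField hreg) (hM i) (hreglr i).1
      (hreglr i).2.1 (fun w => (hYU.weakAssoc u (b i) w).operatorProduct (hreglr i).1)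
      ((hYV.weakAssoc (a i) v' w).operatorProduct (hreglr i).2.1) p q
  -- only the terms with `r < T` contribute to the coefficient of `x₀ ^ p * z ^ q`
  obtain ⟨T, hT, hT'⟩ : ∃ T : ℕ, p + q < 4 * N + T ∧ ∀ i (r : ℕ), T ≤ r →
      (laurentMul (TensorProduct.mk ℂ U V) (A.Y u (b i)) (B.Y (a i) v')).coeff
        (p - r - (α + β)) = 0 := by
    choose n₀ hn₀ using fun i => exists_coeff_eq_zero
      (laurentMul (TensorProduct.mk ℂ U V) (A.Y u (b i)) (B.Y (a i) v'))
    obtain ⟨n₁, hn₁⟩ : ∃ n₁ : ℤ, ∀ i, n₁ ≤ n₀ i :=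
      (Set.finite_range n₀).bddBelow.imp fun _ h i => h ⟨i, rfl⟩
    -- The first summand truncates the substituted series by total degree, the second truncates the
    -- `Y_R` side by the lower bound of the Laurent products.
    refine ⟨(p + q - 4 * N + 1).toNat + (p - (α + β) - n₁ + 1).toNat, by omega,
      fun i r hr => hn₀ i _ ?_⟩
    have := hn₁ i
    omega
  have hright : expandFst (diag F) p q = ∑ i, ∑ r ∈ Finset.range T, (f i).coeff (r - k) •
      (-1 : ℤ) ^ r • expandFst (diag (M i)) (p - r) q := by
    have h1 : expandFst (diag F) p q = expandFst (diag (∑ s ∈ Finset.univ ×ˢ Finset.range T,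
        (f s.1).coeff ((s.2 : ℕ) - k) • (mulDiff gz gy)^[s.2] (M s.1))) p q := by
      refine expandFst_congr fun m => finsum_congr fun s => ?_
      rw [hFsum, Finset.sum_apply, Finset.sum_product]
      refine Finset.sum_congr rfl fun i _ => ?_
      rw [finsum_eq_sum_of_support_subset (s := Finset.range T)]
      · rfl
      · intro r hr
        by_contra hc
        rw [Finset.coe_range, Set.mem_Iio] at hc
        refine hr ?_
        dsimp only
        rw [(hM i).iterate_mulDiff_eq_zero rfl rfl r _ (by simp only [totalDeg]; omega), smul_zero]
    rw [h1, diag_sum _ _ fun s _ => (hMr s.1 s.2).diagFinite,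
      expandFst_sum _ _ fun s _ => (hMr s.1 s.2).isLaurent₂_diag, Finset.sum_apply,
      Finset.sum_apply, Finset.sum_product]
    refine Finset.sum_congr rfl fun i _ => Finset.sum_congr rfl fun r _ => ?_
    rw [diag_iterate_mulDiff' (hM i).diagFinite rfl rfl rfl rfl,
      (hM i).isLaurent₂_diag.expandFst_iterate_mulLin_neg]
    simp only [Pi.smul_apply, shift, sub_zero]
  rw [hright, shift, prodField, mode_apply (twistedY A B R), twistedY_coeff_of_eq_sum A B hR]
  simp only [map_sum, LinearMap.sum_apply]
  refine Finset.sum_congr rfl fun i _ => ?_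
  -- With `n = p - (α + β) - r`, the coefficient of `fᵢ(-s)` needed in `Y_R` has index `r - k`,
  -- matching the expansion in powers of `z - y`.
  let e : ℤ ≃ ℤ := Equiv.subLeft (p - (α + β))
  have hsupp : ∀ r : ℤ, r ∉ Set.Ico (0 : ℤ) T → (negVar (f i)).coeff
      (p - ((α + β + k : ℕ) : ℤ) - (p - (α + β) - r)) •
      (laurentMul (TensorProduct.mk ℂ U V) (A.Y u (b i)) (B.Y (a i) v')).coeff
        (p - (α + β) - r) = 0 := by
    intro r hr
    rw [Set.mem_Ico] at hr
    rcases lt_or_ge r 0 with hlt | hge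
    · rw [negVar_coeff, hk i _ (by push_cast; omega), smul_zero, zero_smul]
    · lift r to ℕ using hge
      rw [show p - (α + β : ℤ) - r = p - r - (α + β) by ring, hT' i r (by omega), smul_zero]
  rw [← finsum_comp_equiv e]
  simp only [e, Equiv.subLeft_apply, sub_zero]
  rw [← finsum_natCast_add _ 0 fun r hr => hsupp r (by rw [Set.mem_Ico]; omega),
    finsum_eq_sum_of_support_subset (s := Finset.range T)]
  · simp only [map_sum, LinearMap.sum_apply]
    refine Finset.sum_congr rfl fun r _ => ?_
    rw [hD, zero_add, show p - ((α + β + k : ℕ) : ℤ) - (p - (α + β) - r) = (r : ℤ) - k by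
      push_cast; ring, show p - (α + β : ℤ) - r = p - r - (α + β) by ring, negVar_coeff, map_smul,
      LinearMap.smul_apply, Int.negOnePow_sub, Int.negOnePow_even (k : ℤ) (by exact_mod_cast hkeven)]
    rw [mul_one, Units.smul_def, smul_assoc, smul_comm]
    congr 1
  · intro r hr
    by_contra hc
    rw [Finset.coe_range, Set.mem_Iio] at hc
    exact hr (hsupp _ (by rw [Set.mem_Ico]; omega))

theorem isModule_jointField {A : VertexData U} {B : VertexData V} (hYU : A.IsModule YU)
    (hYV : B.IsModule YV)
    (hreg : ∀ (u : U) (v : V) (w : W), IsLaurent₂ (prodSeries YU YV u v w))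
    (hex : Exchange YU YV) {R : V ⊗[ℂ] U →ₗ[ℂ] (U ⊗[ℂ] V) ⊗[ℂ] ℂ⸨X⸩}
    (hloc : ∀ (u : U) (v : V), ∃ k : ℕ, ∀ w : W,
      (mulLin (-1) 1)^[k] (prodSeries YV YU v u w) =
        (mulLin (-1) 1)^[k] (twistedSeries YV YU R 1 (-1) v u w)) :
    (twistedTensor A B R).IsModule (jointField hreg) where
  vac_left w := by
    change jointField hreg (A.vac ⊗ₜ B.vac) w = _
    rw [jointField_vac_right hreg hYV.vac_left, hYU.vac_left]
  weakAssoc s t w := by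
    induction s using TensorProduct.induction_on with
    | zero => exact weakAssoc_zero_left t w
    | add s s' hs hs' => exact hs.add_left hs'
    | tmul u v =>
      induction t using TensorProduct.induction_on with
      | zero => exact weakAssoc_zero_right _ w
      | add t t' ht ht' => exact ht.add_right ht'
      | tmul u' v' =>
        obtain ⟨k, hk⟩ := operatorProduct_jointField hYU hYV hreg hex hloc u u' v v' w
        exact weakAssoc_of_operatorProduct hk

end Main

end TwistedTensor

end

open TwistedTensor in
theorem proposition2p12
    {U V W : Type*} [AddCommGroup U] [Module ℂ U] [AddCommGroup V] [Module ℂ V]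
    [AddCommGroup W] [Module ℂ W]
    (A : VertexData U) (hA : A.IsNonlocalVertexAlgebra)
    (B : VertexData V) (hB : B.IsNonlocalVertexAlgebra)
    (R : V ⊗[ℂ] U →ₗ[ℂ] (U ⊗[ℂ] V) ⊗[ℂ] ℂ⸨X⸩)
    (hR : IsTwistingOperator A B R) (hRinv : IsInvertibleOp R)
    (YU : U →ₗ[ℂ] W →ₗ[ℂ] W⸨X⸩) (hYU : A.IsModule YU)
    (YV : V →ₗ[ℂ] W →ₗ[ℂ] W⸨X⸩) (hYV : B.IsModule YV)
    -- `YU(u, x₁) YV(v, x₂) ∈ Hom (W, W((x₁, x₂)))`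
    (hreg : ∀ (u : U) (v : V) (w : W), IsLaurent₂ (prodSeries YU YV u v w))
    -- `YU(u, x₁) YV(v, x₂) w = YV(x₂) (1 ⊗ YU(x₁)) (R⁻¹)¹²(-x₂ + x₁) (u ⊗ v ⊗ w)`
    (hcomm : ∀ (u : U) (v : V) (w : W),
      prodSeries YU YV u v w = twistedSeries YU YV (invOp R hRinv) (-1) 1 u v w)
    -- `(x₂ - x₁)ᵏ YV(v, x₁) YU(u, x₂) w`
    -- ` = (x₂ - x₁)ᵏ YU(x₂) (1 ⊗ YV(x₁)) R¹²(x₂ - x₁) (v ⊗ u ⊗ w)`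
    (hloc : ∀ (u : U) (v : V), ∃ k : ℕ, ∀ w : W,
      (mulLin (-1) 1)^[k] (prodSeries YV YU v u w) =
        (mulLin (-1) 1)^[k] (twistedSeries YV YU R 1 (-1) v u w)) :
    ∃ Y : U ⊗[ℂ] V →ₗ[ℂ] W →ₗ[ℂ] W⸨X⸩,
      ((twistedTensor A B R).IsModule Y ∧
        (∀ u : U, Y (u ⊗ₜ B.vac) = YU u) ∧ (∀ v : V, Y (A.vac ⊗ₜ v) = YV v)) ∧
      -- `Y(u ⊗ v, x) w` is `YU(u, x₁) YV(v, x) w` at `x₁ = x`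
      (∀ (u : U) (v : V) (w : W) (n : ℤ),
        (Y (u ⊗ₜ v) w).coeff n = ∑ᶠ m : ℤ, prodSeries YU YV u v w m (n - m)) ∧
      ∀ Y' : U ⊗[ℂ] V →ₗ[ℂ] W →ₗ[ℂ] W⸨X⸩,
        ((twistedTensor A B R).IsModule Y' ∧
          (∀ u : U, Y' (u ⊗ₜ B.vac) = YU u) ∧ (∀ v : V, Y' (A.vac ⊗ₜ v) = YV v)) →
        Y' = Y := by
  refine ⟨jointField hreg, ⟨isModule_jointField hYU hYV hreg (exchange_of_twistedSeries hcomm) hloc,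
    jointField_vac_right hreg hYV.vac_left, jointField_vac_left hreg hYU.vac_left⟩,
    jointField_coeff hreg, fun Y' hY' => ?_⟩
  exact eq_jointField_of_isModule hreg hA hB hR hY'.1 hY'.2.1 hY'.2.2
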